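/- Let $(R,\mathfrak m)$ be a regular local ring with $\dim R\ge 2$ and fraction field $K$, and let $I$ be an $\mathfrak m$-primary ideal of $R$. A local subring $T$ of $K$ *dominates* a local subring $S$ if $S\subseteq T$ and $\mathfrak m_T\cap S=\mathfrak m_S$. For a subring $A$ of $K$ and a nonzero ideal $J$ of $A$, $\operatorname{Proj} A[Jt]$ is identified with the set of local rings $A[J/a]_P$, where $0\ne a\in J$ and $P\in\operatorname{Spec}A[J/a]$. The normalized blowup $\operatorname{Proj}\overline{R[It]}$ of $I$ is the set of local rings $B_P$, where $B$ is the integral closure in $K$ of $R[I/a]$, $0\ne a\in I$, and $P\in\operatorname{Spec}B$. The set $\operatorname{Rees} I$ of Rees valuation rings of $I$ consists of those $B_P$ for which $P$ is a minimal prime of $IB$. A *local quadratic transform* of a local ring $S$ is a local ring on $\operatorname{Proj}S[\mathfrak m_St]$ that dominates $S$. A regular local ring $S$ is *infinitely near* to $R$ if $\dim S\ge 2$ and $S$ is obtained from $R$ by a finite (possibly empty) sequence of local quadratic transforms. It is a *base point* of $I$ if the transform $I^S=a^{-1}IS$ is a proper ideal of $S$, where $aS$ is the smallest principal ideal of $S$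 containing $IS$. Let $\Gamma$ be the set of base points of $I$, and assume that $\Gamma$ is finite. For $R_i\in\Gamma$ let $\operatorname{ord}_{R_i}$ denote the valuation ring in $K$ of the order function $x\mapsto\sup\{n: x\in\mathfrak m_{R_i}^n\}$. Let $X_\Gamma$ be the model obtained from $\operatorname{Spec}R$ by successively blowing up the points of $\Gamma$: $X_0=\operatorname{Spec}R$ (the set of all $R_P$), $X_{k+1}$ is obtained from $X_k$ by blowing up the maximal ideals of the points in $\Gamma\cap X_k$, and $X_\Gamma=X_k$ for $k\gg0$. Let $f:X_\Gamma\to\operatorname{Proj}\overline{R[It]}$ be the morphism that sends $T$ to the local ring dominated by $T$; $f$ is *biregular at* $S$ if $f^{-1}(S)=\{S\}$. Assume that $\operatorname{ord}_{R_i}\in\operatorname{Rees}I$ for every $R_i\in\Gamma$. If $S\in\operatorname{Proj}\overline{R[It]}$ is contained in $\operatorname{ord}_{R_i}$ for at most one $R_i\in\Gamma$, then the divisor class group of $S$ (Weil divisors modulo principal divisors) is a torsion group, and $f$ is biregular at $S$. -/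

import Mathlib

open IsLocalRing

namespace BlowupModel

noncomputable section

variable {K : Type*} [Field K]

/-! Models are sets of local subrings of a fixed field `K`. The order `S ≤ T` on
`LocalSubring K` is domination: `S ⊆ T` and the maximal ideal of `T` contracts to that of `S`. -/

/-- The affine model of a subring `A` of `K`: all localizations `A_P`, `P ∈ Spec A`. -/
def affineModel (A : Subring K) : Set (LocalSubring K) :=
  {S | ∃ (P : Ideal A) (_ : P.IsPrime), S = LocalSubring.ofPrime A P}

/-- The extension `J B` of an ideal `J` of `A` to a subring `B` of `K` containing `A`. -/
def extendIdeal (A : Subring K) (J : Ideal A) (B : Subring K) : Ideal B :=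
  Ideal.span {b : B | ∃ x ∈ J, (b : K) = (x : K)}

/-- The chart `A[J/a]` of the blowup of `J`. -/
def blowupChart (A : Subring K) (J : Ideal A) (a : A) : Subring K :=
  (Algebra.adjoin A {z : K | ∃ x ∈ J, z = (x : K) / (a : K)}).toSubring

/-- The integral closure in `K` of the chart `A[J/a]`. -/
def normalizedChart (A : Subring K) (J : Ideal A) (a : A) : Subring K :=
  (integralClosure (blowupChart A J a) K).toSubring

/-- The blowup `Proj A[Jt]`: the union of the affine models of the charts `A[J/a]`,
`0 ≠ a ∈ J`. -/
def blowup (A : Subring K) (J : Ideal A) : Set (LocalSubring K) :=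
  {S | ∃ a ∈ J, a ≠ 0 ∧ S ∈ affineModel (blowupChart A J a)}

/-- The normalized blowup (the `Proj` of the integral closure of the Rees algebra `A[Jt]`, for `A`
normal with fraction field `K`): the degree-zero part of the localization of that integral closure
at `at` is the integral closure of `A[J/a]`, so this is the union of the affine models of the
integral closures of the charts. -/
def normalizedBlowup (A : Subring K) (J : Ideal A) : Set (LocalSubring K) :=
  {S | ∃ a ∈ J, a ≠ 0 ∧ S ∈ affineModel (normalizedChart A J a)}

/-- The Rees valuation rings of `J`: localizations of the normalized charts at the minimal primes
of the extension of `J`. -/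
def reesValuationRings (A : Subring K) (J : Ideal A) : Set (LocalSubring K) :=
  {V | ∃ a ∈ J, a ≠ 0 ∧ ∃ (P : Ideal (normalizedChart A J a)) (_ : P.IsPrime),
    P ∈ (extendIdeal A J (normalizedChart A J a)).minimalPrimes ∧
      V = LocalSubring.ofPrime (normalizedChart A J a) P}

/-- `T` is a local quadratic transform of `S`: a point of the blowup of the maximal ideal of `S`
that dominates `S`. -/
def IsLocalQuadraticTransform (S T : LocalSubring K) : Prop :=
  S ≤ T ∧ T ∈ blowup S.toSubring (maximalIdeal S.toSubring)

/-- `S` is infinitely near to `R`: a regular local ring of dimension at least two obtained from `R`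
by a finite, possibly empty, sequence of local quadratic transforms. -/
def IsInfinitelyNear (R S : LocalSubring K) : Prop :=
  IsRegularLocalRing S.toSubring ∧ 2 ≤ ringKrullDim S.toSubring ∧
    Relation.ReflTransGen IsLocalQuadraticTransform R S

/-- `J = a⁻¹ I S`, where `a S` is the smallest principal ideal of `S` containing `I S`. -/
def IsTransform (R S : LocalSubring K) (I : Ideal R.toSubring) (J : Ideal S.toSubring) : Prop :=
  ∃ a : S.toSubring, a ≠ 0 ∧
    IsLeast {L : Ideal S.toSubring | extendIdeal R.toSubring I S.toSubring ≤ L ∧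
      ∃ b, L = Ideal.span {b}} (Ideal.span {a}) ∧
    extendIdeal R.toSubring I S.toSubring = Ideal.span {a} * J

/-- The set `BP(I)` of base points of `I`: infinitely near points in which the transform of `I`
is a proper ideal. -/
def basePoints (R : LocalSubring K) (I : Ideal R.toSubring) : Set (LocalSubring K) :=
  {S | IsInfinitelyNear R S ∧ ∃ J : Ideal S.toSubring, IsTransform R S I J ∧ J ≠ ⊤}

/-- The order function of a local ring, `x ↦ sup {n | x ∈ 𝔪ⁿ}`. -/
def order (S : LocalSubring K) (x : S.toSubring) : ℕ∞ :=
  ⨆ n ∈ {n : ℕ | x ∈ maximalIdeal S.toSubring ^ n}, (n : ℕ∞)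

/-- The order valuation ring: the quotients `x / y` with `ord y ≤ ord x`. -/
def orderValuationRing (S : LocalSubring K) : Set K :=
  {z | ∃ x y : S.toSubring, y ≠ 0 ∧ order S y ≤ order S x ∧ z = (x : K) / (y : K)}

/-- Blow up the points of the model `M` that lie in `Γ`: each such point is replaced by
its local quadratic transforms, the other points are kept. (Stalkwise, this is the blowup of the
ideal sheaf whose stalk is the maximal ideal at the points in `Γ`, and the unit ideal elsewhere.) -/
def blowupPoints (Γ M : Set (LocalSubring K)) : Set (LocalSubring K) :=
  {T | (T ∈ M ∧ T ∉ Γ) ∨ ∃ S ∈ M, S ∈ Γ ∧ IsLocalQuadraticTransform S T}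

/-- `X₀ = Spec R`, and `Xₖ₊₁` is obtained from `Xₖ` by blowing up the points of `Γ` on `Xₖ`. -/
def stage (R : LocalSubring K) (Γ : Set (LocalSubring K)) : ℕ → Set (LocalSubring K)
  | 0 => affineModel R.toSubring
  | k + 1 => blowupPoints Γ (stage R Γ k)

/-- The saturated regular model `X_Γ`: the final value of the sequence `Xₖ`, which for the finite
set of base points of an ideal is constant once every point of `Γ` has been blown up. -/
def saturatedModel (R : LocalSubring K) (Γ : Set (LocalSubring K)) : Set (LocalSubring K) :=
  {T | ∀ᶠ k in Filter.atTop, T ∈ stage R Γ k}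

/-- The fibre over `S` of the domination morphism from the model `X`, which sends `T` to
the point dominated by `T`. -/
def fiber (X : Set (LocalSubring K)) (S : LocalSubring K) : Set (LocalSubring K) :=
  {T | T ∈ X ∧ S ≤ T}

/-- The domination morphism from `X` is biregular at the point `S` of its target. -/
def IsBiregularAt (X : Set (LocalSubring K)) (S : LocalSubring K) : Prop :=
  fiber X S = {S}

/-- The height one primes of a ring. -/
def HeightOnePrime (A : Type*) [CommRing A] : Type _ :=
  {P : Ideal A // P.IsPrime ∧ P.height = 1}

/-- The order of vanishing of `x` along a height one prime `P`, i.e. the length of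
`A_P / x A_P`; for `A` normal this is the normalized discrete valuation of `A_P`. -/
def ordAlong {A : Type*} [CommRing A] (P : HeightOnePrime A) (x : A) : ℕ∞ :=
  haveI := P.2.1
  Ring.ord (Localization.AtPrime P.1) (algebraMap A (Localization.AtPrime P.1) x)

/-- The group of principal divisors, generated by the divisors of the nonzero elements of `A`
(so it contains the divisors of all nonzero fractions). -/
def principalDivisors (A : Type*) [CommRing A] : AddSubgroup (HeightOnePrime A →₀ ℤ) :=
  AddSubgroup.closure {D | ∃ x : A, x ≠ 0 ∧ ∀ P, ∃ n : ℕ, ordAlong P x = n ∧ D P = n}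

/-- The divisor class group of a normal domain: Weil divisors modulo principal divisors. -/
abbrev DivisorClassGroup (A : Type*) [CommRing A] : Type _ :=
  (HeightOnePrime A →₀ ℤ) ⧸ principalDivisors A

end

end BlowupModel

/-!
Regular local rings are unique factorization domains (by finite free resolutions: the determinant of
a resolution shows that the divisor of a prime of height one is principal), and local quadratic
transforms of regular local rings are regular. So the points of every stage `Xₖ` are unique
factorization domains, and each is the intersection of the discrete valuation rings of the prime
divisors containing it: these are the localizations of `R` at primes of height one and the order
valuation rings `ord_Q`, `Q ∈ Γ`.

Let `V` be a valuation ring dominating `S`. As `Γ` is finite, on some stage `V` has a center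
`T ∉ Γ`. There `I` extends to a principal ideal, so `T` contains the normalized chart of `S` and
therefore dominates `S`. As `S` is normal, it is the intersection of the valuation rings that
dominate it, hence also of the prime divisors containing it. It remains to see that any point
`T` of a stage that dominates `S` equals `S`.

Let `z ∈ T`, let `z = y / w` be a reduced fraction over `R`, and let `a ∈ I` be such that `S`
contains `I / a`. At most one `ord_Q` contains `S`, so one can choose `N ≥ 1` and `j` such that
`c = w ^ N / a ^ j` and `d = y ^ N / a ^ j` generate the unit ideal of every prime divisor
containing `S`. Hence `c, d ∈ S`. As `d = z ^ N * c` with `z ∈ T`, the element `c` is a unit in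
every prime divisor containing `T`, thus in `T`, and thus in `S` by domination. So
`z ^ N = d / c ∈ S`, and `z ∈ S` by normality.
-/

universe u

namespace BlowupModel

section RegularLocalRing

variable {R : Type*} [CommRing R]

theorem exists_isUnit_coeff_of_sum_notMem_sq [IsLocalRing R] {ι : Type*} {s : Finset ι}
    {g c : ι → R} (hg : ∀ i ∈ s, g i ∈ maximalIdeal R)
    (hsum : ∑ i ∈ s, c i * g i ∉ maximalIdeal R ^ 2) : ∃ i ∈ s, IsUnit (c i) := by
  by_contra! hc
  refine hsum (Ideal.sum_mem _ fun i hi ↦ ?_)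
  rw [pow_two]
  exact Ideal.mul_mem_mul ((mem_maximalIdeal _).2 (hc i hi)) (hg i hi)

theorem exists_finset_span_insert_eq_maximalIdeal [IsLocalRing R] [IsNoetherianRing R] {x : R}
    (hx : x ∈ maximalIdeal R) (hx2 : x ∉ maximalIdeal R ^ 2) :
    ∃ t : Finset R, t.card + 1 = (maximalIdeal R).spanFinrank ∧
      Ideal.span (insert x (t : Set R)) = maximalIdeal R := by
  classical
  obtain ⟨s, hs, hspan⟩ := Submodule.FG.exists_span_finset_card_eq_spanFinrank
    (maximalIdeal R).fg_of_isNoetherianRing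
  have hsm : ∀ i ∈ s, i ∈ maximalIdeal R := fun i hi ↦ hspan ▸ Submodule.subset_span hi
  obtain ⟨c, -, hc⟩ := Submodule.mem_span_finset.1 (hspan.symm ▸ hx)
  simp only [smul_eq_mul] at hc
  obtain ⟨g, hgs, hgu⟩ := exists_isUnit_coeff_of_sum_notMem_sq (g := id) hsm (c := c)
    (by simpa only [id, hc])
  have hg : g ∈ Ideal.span (insert x (s.erase g : Set R)) := by
    rw [← Ideal.unit_mul_mem_iff_mem _ hgu,
      eq_sub_of_add_eq ((Finset.add_sum_erase s (fun i ↦ c i * i) hgs).trans hc)]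
    exact sub_mem (Ideal.subset_span (Set.mem_insert _ _)) (sum_mem fun i hi ↦
      Ideal.mul_mem_left _ _ (Ideal.subset_span (Set.mem_insert_of_mem _ hi)))
  refine ⟨s.erase g, by rw [Finset.card_erase_add_one hgs, hs], le_antisymm ?_ ?_⟩
  · refine Ideal.span_le.2 (Set.insert_subset hx fun i hi ↦ hsm i (Finset.mem_of_mem_erase hi))
  · refine hspan.ge.trans (Ideal.span_le.2 fun i hi ↦ ?_)
    by_cases hig : i = g
    · exact hig ▸ hg
    · exact Ideal.subset_span (Set.mem_insert_of_mem _ (Finset.mem_erase.2 ⟨hig, hi⟩))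

theorem isLocalRing_quotient_of_le_maximalIdeal [IsLocalRing R] {J : Ideal R}
    (hJ : J ≤ maximalIdeal R) : IsLocalRing (R ⧸ J) :=
  have := Ideal.Quotient.nontrivial_iff.2 (hJ.trans_lt (maximalIdeal.isMaximal R).lt_top).ne
  .of_surjective' _ Ideal.Quotient.mk_surjective

theorem spanFinrank_maximalIdeal_quotient_add_one_le [IsLocalRing R] [IsNoetherianRing R] {x : R}
    [IsLocalRing (R ⧸ Ideal.span {x})] (hx : x ∈ maximalIdeal R) (hx2 : x ∉ maximalIdeal R ^ 2) :
    (maximalIdeal (R ⧸ Ideal.span {x})).spanFinrank + 1 ≤ (maximalIdeal R).spanFinrank := by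
  classical
  obtain ⟨t, ht, hspan⟩ := exists_finset_span_insert_eq_maximalIdeal hx hx2
  set mk := Ideal.Quotient.mk (Ideal.span {x})
  have hmax : maximalIdeal (R ⧸ Ideal.span {x}) = Ideal.span (t.image mk : Set _) := by
    have hmkx : mk x = 0 := Ideal.Quotient.eq_zero_iff_mem.2 (Ideal.mem_span_singleton_self x)
    rw [← map_maximalIdeal_of_surjective mk Ideal.Quotient.mk_surjective, ← hspan, Ideal.map_span,
      Set.image_insert_eq, hmkx, Ideal.span_insert_zero, Finset.coe_image]
  rw [← ht, hmax]
  refine Nat.add_le_add_right ((Submodule.spanFinrank_span_le_ncard_of_finite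
    (Finset.finite_toSet _)).trans ?_) 1
  rw [Set.ncard_coe_finset]
  exact Finset.card_image_le

theorem spanFinrank_maximalIdeal_le_ringKrullDim_quotient_add_one [IsRegularLocalRing R] {x : R}
    (hx : x ∈ maximalIdeal R) :
    ((maximalIdeal R).spanFinrank : WithBot ℕ∞) ≤ ringKrullDim (R ⧸ Ideal.span {x}) + 1 := by
  rw [(isRegularLocalRing_iff R).1 inferInstance]
  simpa using ringKrullDim_le_ringKrullDim_quotient_add_encard ({x} : Set R)
    (by simpa [IsLocalRing.ringJacobson_eq_maximalIdeal] using! hx)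

theorem isRegularLocalRing_quotient_span_singleton [IsRegularLocalRing R] {x : R}
    (hx : x ∈ maximalIdeal R) (hx2 : x ∉ maximalIdeal R ^ 2) :
    ∃ _ : IsRegularLocalRing (R ⧸ Ideal.span {x}),
      (maximalIdeal (R ⧸ Ideal.span {x})).spanFinrank + 1 = (maximalIdeal R).spanFinrank := by
  have := isLocalRing_quotient_of_le_maximalIdeal ((Ideal.span_singleton_le_iff_mem _).2 hx)
  have hrank := spanFinrank_maximalIdeal_quotient_add_one_le hx hx2
  have hdim := spanFinrank_maximalIdeal_le_ringKrullDim_quotient_add_one hx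
  have hreg : IsRegularLocalRing (R ⧸ Ideal.span {x}) := by
    refine IsRegularLocalRing.of_spanFinrank_maximalIdeal_le _
      (ENat.WithBot.add_le_add_one_right_iff.1 (le_trans ?_ hdim))
    exact_mod_cast hrank
  refine ⟨hreg, hrank.antisymm ?_⟩
  rw [← (isRegularLocalRing_iff _).1 hreg] at hdim
  exact_mod_cast hdim

theorem spanFinrank_maximalIdeal_eq_zero_iff_isField [IsLocalRing R] [IsNoetherianRing R] :
    (maximalIdeal R).spanFinrank = 0 ↔ IsField R := by
  rw [isField_iff_maximalIdeal_eq]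
  exact Submodule.spanFinrank_eq_zero_iff_eq_bot (maximalIdeal R).fg_of_isNoetherianRing

theorem isField_of_maximalIdeal_le_sq [IsLocalRing R] [IsNoetherianRing R]
    (h : maximalIdeal R ≤ maximalIdeal R ^ 2) : IsField R :=
  isField_iff_maximalIdeal_eq.2 <| Submodule.eq_bot_of_le_smul_of_le_jacobson_bot (maximalIdeal R)
    _ (maximalIdeal R).fg_of_isNoetherianRing (by simpa [pow_two] using h)
    (maximalIdeal_le_jacobson _)

theorem isField_of_maximalIdeal_mem_minimalPrimes [IsRegularLocalRing R]
    (h : maximalIdeal R ∈ minimalPrimes R) : IsField R := by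
  have hdim := (isRegularLocalRing_iff R).1 inferInstance
  rw [← maximalIdeal_height_eq_ringKrullDim, Ideal.height_eq_zero_iff.2 h] at hdim
  exact spanFinrank_maximalIdeal_eq_zero_iff_isField.1 (by exact_mod_cast hdim)

theorem exists_mem_maximalIdeal_notMem_sq [IsRegularLocalRing R] (h : ¬ IsField R) :
    ∃ x ∈ maximalIdeal R, x ∉ maximalIdeal R ^ 2 ∧ ∀ P ∈ minimalPrimes R, x ∉ P := by
  by_contra! H
  have hcover : (maximalIdeal R : Set R) ⊆
      ⋃ J ∈ insert (maximalIdeal R ^ 2) (minimalPrimes R), (id J : Ideal R) := by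
    intro x hx
    simp only [Set.mem_iUnion]
    by_cases hx2 : x ∈ maximalIdeal R ^ 2
    · exact ⟨_, Set.mem_insert _ _, hx2⟩
    · obtain ⟨P, hP, hxP⟩ := H x hx hx2
      exact ⟨P, Set.mem_insert_of_mem _ hP, hxP⟩
  -- prime avoidance tolerates up to two ideals that are not prime
  rw [Ideal.subset_union_prime_finite (f := id)
    ((minimalPrimes.finite_of_isNoetherianRing R).insert _)
    (maximalIdeal R ^ 2) (maximalIdeal R ^ 2)
    fun i hi hne _ ↦ (hi.resolve_left hne).1.1] at hcover
  obtain ⟨P, rfl | hP, hle⟩ := hcover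
  · exact h (isField_of_maximalIdeal_le_sq hle)
  · obtain rfl : P = maximalIdeal R := (le_maximalIdeal hP.1.1.ne_top).antisymm hle
    exact h (isField_of_maximalIdeal_mem_minimalPrimes hP)

theorem isDomain_of_isPrime_span_singleton [IsLocalRing R] [IsNoetherianRing R] {x : R}
    (hx : (Ideal.span {x}).IsPrime) (hmin : ∀ P ∈ minimalPrimes R, x ∉ P) : IsDomain R := by
  obtain ⟨P, hP, hPx⟩ := Ideal.exists_minimalPrimes_le (I := ⊥) (J := Ideal.span {x}) bot_le
  have hPp := hP.1.1
  have hbot : P = ⊥ := by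
    refine Submodule.eq_bot_of_le_smul_of_le_jacobson_bot (maximalIdeal R) _
      P.fg_of_isNoetherianRing (fun p hp ↦ ?_) (maximalIdeal_le_jacobson _)
    obtain ⟨r, rfl⟩ := Ideal.mem_span_singleton.1 (hPx hp)
    exact Ideal.mul_mem_mul (le_maximalIdeal hx.ne_top (Ideal.mem_span_singleton_self x))
      ((hPp.mem_or_mem hp).resolve_left (hmin P hP))
  have : (⊥ : Ideal R).IsPrime := hbot ▸ hPp
  exact IsDomain.of_bot_isPrime R

theorem isDomain_of_spanFinrank_maximalIdeal_eq (n : ℕ) : ∀ (R : Type*) [CommRing R]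
    [IsRegularLocalRing R], (maximalIdeal R).spanFinrank = n → IsDomain R := by
  induction n with
  | zero => exact fun R _ _ h ↦ (spanFinrank_maximalIdeal_eq_zero_iff_isField.1 h).isDomain
  | succ n ih =>
    intro R _ _ h
    have hf : ¬ IsField R := by rw [← spanFinrank_maximalIdeal_eq_zero_iff_isField]; lia
    obtain ⟨x, hx, hx2, hxP⟩ := exists_mem_maximalIdeal_notMem_sq hf
    obtain ⟨_, hrank⟩ := isRegularLocalRing_quotient_span_singleton hx hx2
    exact isDomain_of_isPrime_span_singleton ((Ideal.Quotient.isDomain_iff_prime _).1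
      (ih (R ⧸ Ideal.span {x}) (by lia))) hxP

instance isDomain_of_isRegularLocalRing [IsRegularLocalRing R] : IsDomain R :=
  isDomain_of_spanFinrank_maximalIdeal_eq _ R rfl

theorem prime_of_mem_maximalIdeal_of_notMem_sq [IsRegularLocalRing R] {x : R}
    (hx : x ∈ maximalIdeal R) (hx2 : x ∉ maximalIdeal R ^ 2) : Prime x := by
  obtain ⟨_, -⟩ := isRegularLocalRing_quotient_span_singleton hx hx2
  have h0 : x ≠ 0 := fun h ↦ hx2 (h ▸ zero_mem _)
  rw [← Ideal.span_singleton_prime h0, ← Ideal.Quotient.isDomain_iff_prime]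
  infer_instance

@[elab_as_elim]
theorem isRegularLocalRing_induction {motive : ∀ (R : Type u) [CommRing R], Prop}
    (field : ∀ (R : Type u) [CommRing R], IsField R → motive R)
    (quotient : ∀ (R : Type u) [CommRing R] [IsRegularLocalRing R] (x : R), Prime x →
      IsRegularLocalRing (R ⧸ Ideal.span {x}) → motive (R ⧸ Ideal.span {x}) → motive R)
    (R : Type u) [CommRing R] [IsRegularLocalRing R] : motive R := by
  obtain ⟨n, hn⟩ : ∃ n, (maximalIdeal R).spanFinrank = n := ⟨_, rfl⟩
  induction n generalizing R with
  | zero => exact field R (spanFinrank_maximalIdeal_eq_zero_iff_isField.1 hn)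
  | succ n ih =>
    have hf : ¬ IsField R := by rw [← spanFinrank_maximalIdeal_eq_zero_iff_isField]; lia
    obtain ⟨x, hx, hx2, -⟩ := exists_mem_maximalIdeal_notMem_sq hf
    obtain ⟨hreg, hrank⟩ := isRegularLocalRing_quotient_span_singleton hx hx2
    exact quotient R x (prime_of_mem_maximalIdeal_of_notMem_sq hx hx2) hreg (ih _ (by lia))

theorem isIntegrallyClosed_iff_forall_dvd_of_pow_dvd_mul_pow [IsDomain R] [IsNoetherianRing R] :
    IsIntegrallyClosed R ↔
      ∀ a b d : R, b ≠ 0 → d ≠ 0 → (∀ k : ℕ, b ^ k ∣ d * a ^ k) → b ∣ a := by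
  have hinj := FaithfulSMul.algebraMap_injective R (FractionRing R)
  have halg : ∀ a b d : R, b ≠ 0 → ∀ k c, d * a ^ k = b ^ k * c ↔
      algebraMap R (FractionRing R) c = d • (algebraMap R _ a / algebraMap R _ b) ^ k := by
    intro a b d hb k c
    have hb' : algebraMap R (FractionRing R) b ≠ 0 := (map_ne_zero_iff _ hinj).2 hb
    rw [← hinj.eq_iff, Algebra.smul_def, div_pow, ← mul_div_assoc, eq_div_iff (pow_ne_zero k hb'),
      map_mul, map_mul, map_pow, map_pow, mul_comm (_ ^ k) (algebraMap R _ c), eq_comm]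
  rw [isIntegrallyClosed_iff (FractionRing R)]
  constructor
  · intro h a b d hb hd hdvd
    have hint : IsAlmostIntegral R (algebraMap R (FractionRing R) a / algebraMap R _ b) :=
      ⟨d, mem_nonZeroDivisors_of_ne_zero hd, fun k ↦
        (hdvd k).imp fun c hc ↦ (halg a b d hb k c).1 hc⟩
    obtain ⟨c, hc⟩ := h hint.isIntegral
    exact ⟨c, by simpa using (halg a b 1 hb 1 c).2 (by simpa using hc)⟩
  · intro h z hz
    obtain ⟨d, hd, hdz⟩ := hz.isAlmostIntegral
    obtain ⟨a, b, hb, rfl⟩ := IsFractionRing.div_surjective (A := R) z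
    have hb0 := nonZeroDivisors.ne_zero hb
    obtain ⟨c, hc⟩ := h a b d hb0 (nonZeroDivisors.ne_zero hd) fun k ↦
      (hdz k).imp fun c hc ↦ (halg a b d hb0 k c).2 hc
    exact ⟨c, by simpa using (halg a b 1 hb0 1 c).1 (by simpa using hc)⟩

theorem dvd_of_dvd_pow_mul [IsDomain R] {x y z : R} {n : ℕ} (hx : Prime x) (hy : ¬ x ∣ y)
    (h : y ∣ x ^ n * z) : y ∣ z := by
  obtain ⟨e, he⟩ := h
  obtain ⟨e, rfl⟩ := hx.pow_dvd_of_dvd_mul_left n hy ⟨z, he.symm⟩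
  exact ⟨e, mul_left_cancel₀ (pow_ne_zero n hx.ne_zero) (he.trans (mul_left_comm _ _ _))⟩

theorem pow_dvd_mul_sub_mul_pow {a b c d : R} (h : ∀ k : ℕ, b ^ k ∣ d * a ^ k) (k : ℕ) :
    b ^ k ∣ d * (a - b * c) ^ k := by
  rw [sub_eq_add_neg, add_pow, Finset.mul_sum]
  refine Finset.dvd_sum fun i hi ↦ ?_
  have hik : i + (k - i) = k := by have := Finset.mem_range.1 hi; lia
  rw [show d * (a ^ i * (-(b * c)) ^ (k - i) * (k.choose i)) =
    (d * a ^ i) * (b ^ (k - i) * ((-c) ^ (k - i) * (k.choose i))) by rw [← mul_neg, mul_pow]; ring]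
  conv_lhs => rw [← hik, pow_add]
  exact mul_dvd_mul (h i) (dvd_mul_right _ _)

theorem pow_dvd_of_forall_pow_dvd_mul_pow [IsDomain R] [IsNoetherianRing R] {x a d : R} {q : ℕ}
    (hx : Prime x) (hd : d ≠ 0) (h : ∀ k : ℕ, (x ^ q) ^ k ∣ d * a ^ k) : x ^ q ∣ a := by
  have hfin := finiteMultiplicity_iff_emultiplicity_ne_top.1
    (FiniteMultiplicity.of_not_isUnit hx.not_isUnit hd)
  obtain ⟨s, hs⟩ := ENat.ne_top_iff_exists.1 hfin
  have hk := pow_dvd_iff_le_emultiplicity.1 ((pow_mul x q (s + 1)).symm ▸ h (s + 1))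
  rw [emultiplicity_mul hx, emultiplicity_pow hx, ← hs] at hk
  refine pow_dvd_iff_le_emultiplicity.2 ?_
  rcases eq_or_ne (emultiplicity x a) ⊤ with htop | htop
  · exact htop ▸ le_top
  obtain ⟨p, hp⟩ := ENat.ne_top_iff_exists.1 htop
  rw [← hp] at hk ⊢
  norm_cast at hk ⊢
  by_contra! hlt
  nlinarith

theorem dvd_of_forall_exists_eq_mul_add_pow_mul [IsLocalRing R] [IsNoetherianRing R] {x a b : R}
    (hx : ¬ IsUnit x) (h : ∀ n : ℕ, ∃ c r, a = b * c + x ^ n * r) : b ∣ a := by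
  rw [← Ideal.mem_span_singleton, ← Submodule.Quotient.mk_eq_zero, ← Submodule.mem_bot R,
    ← Ideal.iInf_pow_smul_eq_bot_of_isLocalRing (M := R ⧸ Ideal.span {b}) (Ideal.span {x})
      (by rwa [Ne, Ideal.span_singleton_eq_top]), Submodule.mem_iInf]
  intro n
  obtain ⟨c, r, rfl⟩ := h n
  rw [Submodule.Quotient.mk_add, (Submodule.Quotient.mk_eq_zero _).2
    (Ideal.mul_mem_right _ _ (Ideal.mem_span_singleton_self b)), zero_add, ← smul_eq_mul,
    Submodule.Quotient.mk_smul]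
  exact Submodule.smul_mem_smul (Ideal.pow_mem_pow (Ideal.mem_span_singleton_self x) n) trivial

theorem exists_eq_mul_add_mul_of_forall_pow_dvd [IsDomain R] [IsNoetherianRing R] {x : R}
    [IsDomain (R ⧸ Ideal.span {x})] [IsIntegrallyClosed (R ⧸ Ideal.span {x})] (hx : Prime x)
    {a b d : R} (hb : ¬ x ∣ b) (hd : ¬ x ∣ d) (h : ∀ k : ℕ, b ^ k ∣ d * a ^ k) :
    ∃ c r, a = b * c + x * r ∧ ∀ k : ℕ, b ^ k ∣ d * r ^ k := by
  have hmk : ∀ y : R, Ideal.Quotient.mk (Ideal.span {x}) y = 0 ↔ x ∣ y := fun y ↦ by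
    rw [Ideal.Quotient.eq_zero_iff_mem, Ideal.mem_span_singleton]
  obtain ⟨c, hc⟩ := isIntegrallyClosed_iff_forall_dvd_of_pow_dvd_mul_pow.1
    (inferInstance : IsIntegrallyClosed (R ⧸ Ideal.span {x})) (Ideal.Quotient.mk _ a)
    (Ideal.Quotient.mk _ b) (Ideal.Quotient.mk _ d) (by rwa [Ne, hmk]) (by rwa [Ne, hmk])
    fun k ↦ by simpa using map_dvd (Ideal.Quotient.mk (Ideal.span {x})) (h k)
  obtain ⟨c, rfl⟩ := Ideal.Quotient.mk_surjective c
  rw [← map_mul, ← sub_eq_zero, ← map_sub, hmk] at hc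
  obtain ⟨r, hr⟩ := hc
  refine ⟨c, r, by rw [← hr]; ring, fun k ↦ ?_⟩
  have hk := pow_dvd_mul_sub_mul_pow (c := c) h k
  rw [hr, mul_pow, mul_left_comm] at hk
  exact dvd_of_dvd_pow_mul hx (fun hxb ↦ hb (hx.dvd_of_dvd_pow hxb)) hk

theorem dvd_of_forall_pow_dvd_of_not_dvd [IsDomain R] [IsLocalRing R] [IsNoetherianRing R] {x : R}
    [IsDomain (R ⧸ Ideal.span {x})] [IsIntegrallyClosed (R ⧸ Ideal.span {x})] (hx : Prime x)
    {a b d : R} (hb : ¬ x ∣ b) (hd : ¬ x ∣ d) (h : ∀ k : ℕ, b ^ k ∣ d * a ^ k) : b ∣ a := by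
  have happrox : ∀ n : ℕ, ∃ c r, a = b * c + x ^ n * r ∧ ∀ k : ℕ, b ^ k ∣ d * r ^ k := by
    intro n
    induction n with
    | zero => exact ⟨0, a, by ring, h⟩
    | succ n ih =>
      obtain ⟨c, r, rfl, hr⟩ := ih
      obtain ⟨c', r', rfl, hr'⟩ := exists_eq_mul_add_mul_of_forall_pow_dvd hx hb hd hr
      exact ⟨c + x ^ n * c', r', by ring, hr'⟩
  exact dvd_of_forall_exists_eq_mul_add_pow_mul hx.not_isUnit fun n ↦
    (happrox n).imp fun c ↦ .imp fun r ↦ And.left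

theorem isIntegrallyClosed_of_isIntegrallyClosed_quotient [IsDomain R] [IsLocalRing R]
    [IsNoetherianRing R] {x : R} [IsDomain (R ⧸ Ideal.span {x})]
    [IsIntegrallyClosed (R ⧸ Ideal.span {x})] (hx : Prime x) : IsIntegrallyClosed R := by
  rw [isIntegrallyClosed_iff_forall_dvd_of_pow_dvd_mul_pow]
  intro a b d hb hd h
  obtain ⟨q, b, hxb, rfl⟩ := WfDvdMonoid.max_power_factor hb hx.irreducible
  obtain ⟨s, e, hxe, hde⟩ := WfDvdMonoid.max_power_factor hd hx.irreducible
  obtain ⟨a, rfl⟩ := pow_dvd_of_forall_pow_dvd_mul_pow hx hd fun k ↦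
    (pow_dvd_pow_of_dvd (dvd_mul_right (x ^ q) b) k).trans (h k)
  refine mul_dvd_mul_left _ (dvd_of_forall_pow_dvd_of_not_dvd hx hxb hxe fun k ↦ ?_)
  refine dvd_of_dvd_pow_mul (n := s) hx (fun hxk ↦ hxb (hx.dvd_of_dvd_pow hxk)) ?_
  refine (mul_dvd_mul_iff_left (pow_ne_zero k (pow_ne_zero q hx.ne_zero))).1 ?_
  convert! h k using 1
  · rw [mul_pow]
  · rw [hde]; ring

instance isIntegrallyClosed_of_isRegularLocalRing [IsRegularLocalRing R] :
    IsIntegrallyClosed R := by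
  refine isRegularLocalRing_induction (motive := fun R _ ↦ IsIntegrallyClosed R)
    (fun R _ hR ↦ ?_) (fun R _ _ x hx _ _ ↦ isIntegrallyClosed_of_isIntegrallyClosed_quotient hx) R
  let := hR.toField
  infer_instance

end RegularLocalRing

section NormalNoetherian

variable {R : Type*} [CommRing R] [IsDomain R] [IsNoetherianRing R]

theorem exists_mem_notMem_mul_eq_mul [IsIntegrallyClosed R] {a z : R} {P : Ideal R} (ha : a ≠ 0)
    (hP0 : P ≠ ⊥) (hz : ¬ a ∣ z) (hP : ∀ v ∈ P, a ∣ v * z) :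
    ∃ v ∈ P, ∃ u ∉ P, v * z = a * u := by
  by_contra! H
  obtain ⟨w, hw, hw0⟩ := P.ne_bot_iff.1 hP0
  refine hz (isIntegrallyClosed_iff_forall_dvd_of_pow_dvd_mul_pow.1 ‹_› z a w ha hw0 fun k ↦ ?_)
  suffices h : ∃ u ∈ P, w * z ^ k = a ^ k * u from h.imp fun _ ↦ And.right
  induction k with
  | zero => exact ⟨w, hw, by simp⟩
  | succ k ih =>
    obtain ⟨u, hu, h⟩ := ih
    obtain ⟨u', h'⟩ := hP u hu
    exact ⟨u', by_contra fun hu' ↦ H u hu u' hu' h', by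
      rw [pow_succ, ← mul_assoc, h, mul_assoc, h', pow_succ, mul_assoc]⟩

theorem height_eq_one_of_forall_mem_iff_dvd_mul [IsIntegrallyClosed R] {a z : R} (ha : a ≠ 0)
    (P : Ideal R) [P.IsPrime] (hP : ∀ r, r ∈ P ↔ a ∣ r * z) : P.height = 1 := by
  have hz : ¬ a ∣ z := fun h ↦ ‹P.IsPrime›.one_notMem ((hP 1).2 (by simpa using h))
  have hP0 : P ≠ ⊥ := P.ne_bot_iff.2 ⟨a, (hP a).2 (dvd_mul_right _ _), ha⟩
  obtain ⟨w, hw, u, hu, h⟩ := exists_mem_notMem_mul_eq_mul ha hP0 hz fun v ↦ (hP v).1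
  have hmin : P ∈ (Ideal.span {w}).minimalPrimes := by
    refine ⟨⟨inferInstance, (Ideal.span_singleton_le_iff_mem _).2 hw⟩, ?_⟩
    rintro q ⟨hq, hwq⟩ hqP v hv
    obtain ⟨u', hu'⟩ := (hP v).1 hv
    have hvu : v * u = u' * w := mul_left_cancel₀ ha <|
      calc a * (v * u) = v * (a * u) := by ring
        _ = w * (v * z) := by rw [← h]; ring
        _ = a * (u' * w) := by rw [hu']; ring
    have hmem : v * u ∈ q := hvu ▸ q.mul_mem_left _ (hwq (Ideal.mem_span_singleton_self w))
    exact (hq.mem_or_mem hmem).resolve_right fun h ↦ hu (hqP h)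
  refine le_antisymm (Ideal.height_le_one_of_isPrincipal_of_mem_minimalPrimes _ P hmin) ?_
  rwa [Order.one_le_iff_ne_zero, Ne, Ideal.height_eq_zero_iff,
    IsDomain.minimalPrimes_eq_singleton_bot]

theorem dvd_iff_forall_height_eq_one [IsIntegrallyClosed R] {a y : R} (ha : a ≠ 0) :
    a ∣ y ↔ ∀ q : Ideal R, q.IsPrime → q.height = 1 → ∃ s ∉ q, a ∣ s * y := by
  refine ⟨fun h q hq _ ↦ ⟨1, hq.one_notMem, by simpa using h⟩, fun h ↦ ?_⟩
  by_contra hy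
  have hcolon (z r : R) : r ∈ (⊥ : Submodule R (R ⧸ Ideal.span {a})).colon
      {Ideal.Quotient.mk (Ideal.span {a}) z} ↔ a ∣ r * z := by
    rw [Submodule.mem_colon_singleton, Submodule.mem_bot, ← Ideal.mem_span_singleton,
      ← Ideal.Quotient.eq_zero_iff_mem]
    rfl
  have hy0 : Ideal.Quotient.mk (Ideal.span {a}) y ≠ 0 := by
    rwa [Ne, Ideal.Quotient.eq_zero_iff_mem, Ideal.mem_span_singleton]
  obtain ⟨P, hass, hle⟩ := exists_le_isAssociatedPrime_of_isNoetherianRing R _ hy0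
  obtain ⟨hPp, z, hz⟩ := isAssociatedPrime_iff.1 hass
  obtain ⟨z, rfl⟩ := Ideal.Quotient.mk_surjective z
  obtain ⟨s, hs, hsy⟩ := h P hPp (height_eq_one_of_forall_mem_iff_dvd_mul (z := z) ha P fun r ↦ by
    rw [hz, hcolon])
  exact hs (hle ((hcolon _ _).2 hsy))

theorem isDiscreteValuationRing_of_ringKrullDim_eq_one [IsLocalRing R] [IsIntegrallyClosed R]
    (h : ringKrullDim R = 1) : IsDiscreteValuationRing R := by
  have hf : ¬ IsField R := fun hf ↦ zero_ne_one (ringKrullDim_eq_zero_of_isField hf ▸ h)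
  have : Ring.KrullDimLE 1 R := Ring.krullDimLE_iff.2 h.le
  have hmax (P : Ideal R) (hP : P ≠ ⊥) (hPp : P.IsPrime) : P = maximalIdeal R :=
    eq_maximalIdeal (hPp.isMaximal_of_ne_bot hP)
  have : IsPrincipalIdealRing R :=
    ((tfae_of_isNoetherianRing_of_isLocalRing_of_isDomain R).out 0 3 :
      _ ↔ IsIntegrallyClosed R ∧ ∀ P : Ideal R, P ≠ ⊥ → P.IsPrime → P = maximalIdeal R).2
      ⟨inferInstance, hmax⟩
  exact { not_a_field' := isField_iff_maximalIdeal_eq.not.1 hf }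

theorem isDiscreteValuationRing_of_height_eq_one [IsIntegrallyClosed R] (q : Ideal R) [q.IsPrime]
    (hq : q.height = 1) (A : Type*) [CommRing A] [Algebra R A] [IsLocalization.AtPrime A q]
    [IsDomain A] : IsDiscreteValuationRing A := by
  have := IsLocalization.AtPrime.isLocalRing A q
  have := IsLocalization.isNoetherianRing q.primeCompl A inferInstance
  have := isIntegrallyClosed_of_isLocalization A q.primeCompl q.primeCompl_le_nonZeroDivisors
  refine isDiscreteValuationRing_of_ringKrullDim_eq_one ?_
  rw [IsLocalization.AtPrime.ringKrullDim_eq_height q, hq]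
  rfl

end NormalNoetherian

theorem height_eq_one_of_isDiscreteValuationRing {R : Type*} [CommRing R] (q : Ideal R) [q.IsPrime]
    (A : Type*) [CommRing A] [Algebra R A] [IsLocalization.AtPrime A q] [IsDomain A]
    [IsDiscreteValuationRing A] : q.height = 1 := by
  have hdim := IsLocalization.AtPrime.ringKrullDim_eq_height q A
  rw [IsDiscreteValuationRing.ringKrullDim_eq_one] at hdim
  exact_mod_cast hdim.symm

section FreeResolution

/-- `M` has a resolution of length at most `n` by finite free modules, except that the last module
is only required to be free. -/
def HasFreeResolutionLE (R : Type u) [CommRing R] :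
    ℕ → ∀ (M : Type u) [AddCommGroup M] [Module R M], Prop
  | 0, M, _, _ => Module.Free R M
  | n + 1, M, _, _ => ∃ (m : ℕ) (f : (Fin m → R) →ₗ[R] M), Function.Surjective f ∧
      HasFreeResolutionLE R n (LinearMap.ker f)

variable {R : Type u} [CommRing R]

theorem HasFreeResolutionLE.of_linearEquiv {n : ℕ} {M N : Type u} [AddCommGroup M] [Module R M]
    [AddCommGroup N] [Module R N] (e : M ≃ₗ[R] N) (h : HasFreeResolutionLE R n M) :
    HasFreeResolutionLE R n N := by
  cases n with
  | zero =>
    have : Module.Free R M := h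
    exact Module.Free.of_equiv e
  | succ n =>
    obtain ⟨m, f, hf, hK⟩ := h
    refine ⟨m, e.toLinearMap ∘ₗ f, e.surjective.comp hf, ?_⟩
    rwa [LinearEquiv.ker_comp]

open Pointwise in
theorem nonempty_quotSMulTop_ker_linearEquiv {x : R} {F F' M : Type*} [AddCommGroup F] [Module R F]
    [AddCommGroup F'] [Module R F'] [AddCommGroup M] [Module R M] {π : F →ₗ[R] F'} {g : F →ₗ[R] M}
    {f : F' →ₗ[R] QuotSMulTop x M} (hx : IsSMulRegular M x) (hg : Function.Surjective g)
    (hπ : Function.Surjective π) (hker : LinearMap.ker π = x • (⊤ : Submodule R F))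
    (hfg : ∀ v, f (π v) = Submodule.Quotient.mk (g v)) :
    Nonempty (QuotSMulTop x (LinearMap.ker g) ≃ₗ[R] LinearMap.ker f) := by
  let ρ : LinearMap.ker g →ₗ[R] LinearMap.ker f :=
    π.restrict fun k hk ↦ by rw [LinearMap.mem_ker, hfg, LinearMap.mem_ker.1 hk]; rfl
  have hρs : Function.Surjective ρ := by
    rintro ⟨v, hv⟩
    obtain ⟨v, rfl⟩ := hπ v
    rw [LinearMap.mem_ker, hfg, Submodule.Quotient.mk_eq_zero] at hv
    obtain ⟨m, -, hm⟩ := (Submodule.mem_smul_pointwise_iff_exists _ _ _).1 hv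
    obtain ⟨w, rfl⟩ := hg m
    refine ⟨⟨v - x • w, by simp [← hm]⟩, Subtype.ext ?_⟩
    have hw : π (x • w) = 0 :=
      LinearMap.mem_ker.1 (hker ▸ Submodule.smul_mem_pointwise_smul _ _ _ trivial)
    simp [ρ, hw]
  have hρk : LinearMap.ker ρ = x • (⊤ : Submodule R (LinearMap.ker g)) := by
    ext ⟨k, hk⟩
    have hπk : ρ ⟨k, hk⟩ = 0 ↔ k ∈ x • (⊤ : Submodule R F) := by
      rw [← hker, LinearMap.mem_ker, ← Subtype.coe_inj]
      rfl
    rw [LinearMap.mem_ker, hπk]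
    simp only [Submodule.mem_smul_pointwise_iff_exists, Submodule.mem_top, true_and]
    constructor
    · rintro ⟨r, rfl⟩
      rw [LinearMap.mem_ker, map_smul] at hk
      exact ⟨⟨r, hx.right_eq_zero_of_smul hk⟩, rfl⟩
    · rintro ⟨r, hr⟩
      exact ⟨r, congrArg Subtype.val hr⟩
  exact ⟨(Submodule.quotEquivOfEq _ _ hρk.symm).trans (ρ.quotKerEquivOfSurjective hρs)⟩

open Pointwise in
theorem ker_compLeft_mkₐ_span_singleton (x : R) (ι : Type*) :
    LinearMap.ker ((Ideal.Quotient.mkₐ R (Ideal.span {x})).toLinearMap.compLeft ι) =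
      x • (⊤ : Submodule R (ι → R)) := by
  ext v
  simp only [LinearMap.mem_ker, funext_iff, LinearMap.compLeft_apply, Function.comp_apply,
    AlgHom.toLinearMap_apply, Ideal.Quotient.mkₐ_eq_mk, Pi.zero_apply,
    Ideal.Quotient.eq_zero_iff_mem, Ideal.mem_span_singleton,
    Submodule.mem_smul_pointwise_iff_exists, Submodule.mem_top, true_and]
  constructor
  · intro h
    choose w hw using h
    exact ⟨w, fun i ↦ (hw i).symm⟩
  · exact fun ⟨w, hw⟩ i ↦ ⟨w i, (hw i).symm⟩

open Pointwise in
theorem HasFreeResolutionLE.of_quotSMulTop [IsDomain R] [IsLocalRing R] [IsNoetherianRing R] {x : R}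
    (hx0 : x ≠ 0) (hx : x ∈ maximalIdeal R) {n : ℕ} : ∀ (M : Type u) [AddCommGroup M] [Module R M]
    [Module.Finite R M], IsSMulRegular M x →
      HasFreeResolutionLE (R ⧸ Ideal.span {x}) n (QuotSMulTop x M) → HasFreeResolutionLE R n M := by
  have hjac : x ∈ (⊥ : Ideal R).jacobson := maximalIdeal_le_jacobson _ hx
  induction n with
  | zero =>
    intro M _ _ _ hreg h
    have := Module.finitePresentation_of_finite R M
    exact (Module.free_quotSMulTop_iff_free R M hjac hreg).1 h
  | succ n ih =>
    rintro M _ _ _ hreg ⟨m, f, hf, hK⟩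
    let π := (Ideal.Quotient.mkₐ R (Ideal.span {x})).toLinearMap.compLeft (Fin m)
    have hπ : Function.Surjective π := Ideal.Quotient.mk_surjective.comp_left
    obtain ⟨g, hg⟩ := Module.projective_lifting_property (Submodule.mkQ (x • (⊤ : Submodule R M)))
      (f.restrictScalars R ∘ₗ π) (Submodule.mkQ_surjective _)
    have hfg : ∀ v, f (π v) = Submodule.Quotient.mk (g v) := fun v ↦ (LinearMap.congr_fun hg v).symm
    have hgs : Function.Surjective g := by
      refine g.surjective_of_surjective_comp_mkQ (Ideal.span {x}) (by simpa using hjac) ?_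
      rw [Submodule.ideal_span_singleton_smul, hg]
      exact hf.comp hπ
    have hregF : IsSMulRegular (Fin m → R) x := smul_right_injective _ hx0
    obtain ⟨e : QuotSMulTop x (LinearMap.ker g) ≃ₗ[R] LinearMap.ker f⟩ :=
      nonempty_quotSMulTop_ker_linearEquiv (f := f.restrictScalars R) hreg hgs hπ
        (ker_compLeft_mkₐ_span_singleton x (Fin m)) hfg
    exact ⟨m, g, hgs, ih _ (hregF.submodule _ _)
      (hK.of_linearEquiv (e.extendScalarsOfSurjective Ideal.Quotient.mk_surjective).symm)⟩

theorem exists_forall_hasFreeResolutionLE [IsRegularLocalRing R] :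
    ∃ n, ∀ (M : Type u) [AddCommGroup M] [Module R M] [Module.Finite R M],
      HasFreeResolutionLE R n M := by
  refine isRegularLocalRing_induction (motive := fun R _ ↦ ∃ n, ∀ (M : Type u) [AddCommGroup M]
    [Module R M] [Module.Finite R M], HasFreeResolutionLE R n M) (fun R _ hR ↦ ?_)
    (fun R _ _ x hx _ ⟨n, hn⟩ ↦ ⟨n + 1, fun M _ _ _ ↦ ?_⟩) R
  · let := hR.toField
    exact ⟨0, fun M _ _ _ ↦ Module.Free.of_divisionRing R M⟩
  · obtain ⟨m, f, hf⟩ := Module.Finite.exists_fin' R M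
    have := Module.Finite.of_restrictScalars_finite R (R ⧸ Ideal.span {x})
      (QuotSMulTop x (LinearMap.ker f))
    have hreg : IsSMulRegular (Fin m → R) x := smul_right_injective _ hx.ne_zero
    exact ⟨m, f, hf, .of_quotSMulTop hx.ne_zero ((mem_maximalIdeal x).2 hx.not_isUnit) _
      (hreg.submodule _ _) (hn _)⟩

end FreeResolution

section LengthDet

variable {A : Type*} [CommRing A] [IsDomain A]

theorem ord_finset_prod {ι : Type*} {s : Finset ι} {a : ι → A} (ha : ∀ i ∈ s, a i ≠ 0) :
    Ring.ord A (∏ i ∈ s, a i) = ∑ i ∈ s, Ring.ord A (a i) := by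
  classical
  induction s using Finset.induction_on with
  | empty => simp
  | insert i s hi ih =>
    rw [Finset.prod_insert hi, Finset.sum_insert hi,
      Ring.ord_mul' A (mem_nonZeroDivisors_of_ne_zero (ha i (Finset.mem_insert_self _ _))),
      ih fun j hj ↦ ha j (Finset.mem_insert_of_mem hj)]

theorem length_quotient_range_eq_ord_det {M : Type*} [IsPrincipalIdealRing A] [AddCommGroup M]
    [Module A M] [Module.Free A M] [Module.Finite A M] (g : M →ₗ[A] M)
    (hg : Function.Injective g) :
    Module.length A (M ⧸ LinearMap.range g) = Ring.ord A (LinearMap.det g) := by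
  classical
  let e := LinearEquiv.ofInjective g hg
  let b := Module.Free.chooseBasis A M
  have hrank := e.symm.finrank_eq
  let a := Submodule.smithNormalFormCoeffs b hrank
  let b₁ := Submodule.smithNormalFormTopBasis b hrank
  let b₂ := Submodule.smithNormalFormBotBasis b hrank
  let d := (LinearMap.range g).subtype ∘ₗ (b₁.equiv b₂ (Equiv.refl _)).toLinearMap
  have hd : LinearMap.det d = ∏ i, a i := by
    have hmat : LinearMap.toMatrix b₁ b₁ d = Matrix.diagonal a := by
      ext i j
      simp [LinearMap.toMatrix_apply, d, a, b₁, b₂, Matrix.diagonal_apply, Finsupp.single_apply,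
        eq_comm]
      grind
    rw [← LinearMap.det_toMatrix b₁, hmat, Matrix.det_diagonal]
  have hassoc : Associated (LinearMap.det g) (LinearMap.det d) :=
    LinearMap.associated_det_comp_equiv (LinearMap.range g).subtype e _
  rw [Ring.ord_eq_of_associated hassoc, hd,
    ord_finset_prod fun i _ ↦ Submodule.smithNormalFormCoeffs_ne_zero b hrank i,
    ((LinearMap.range g).quotientEquivPiSpan b hrank).length_eq, Module.length_pi_of_fintype]
  rfl

end LengthDet

section LocalLength

open TensorProduct

variable {R : Type*} [CommRing R]

/-- The length of the localization `M_q`, realized as the base change of `M` to `R_q`. -/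
noncomputable def localLength (q : Ideal R) [q.IsPrime] (M : Type*) [AddCommGroup M]
    [Module R M] : ℕ∞ :=
  Module.length (Localization.AtPrime q) (Localization.AtPrime q ⊗[R] M)

variable (q : Ideal R) [q.IsPrime]

theorem localLength_congr {M N : Type*} [AddCommGroup M] [Module R M] [AddCommGroup N] [Module R N]
    (e : M ≃ₗ[R] N) : localLength q M = localLength q N :=
  (e.baseChange R (Localization.AtPrime q) M N).length_eq

theorem localLength_eq_add_of_exact {M N P : Type*} [AddCommGroup M] [Module R M] [AddCommGroup N]
    [Module R N] [AddCommGroup P] [Module R P] {f : M →ₗ[R] N} {g : N →ₗ[R] P}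
    (hf : Function.Injective f) (hg : Function.Surjective g) (h : Function.Exact f g) :
    localLength q N = localLength q M + localLength q P :=
  Module.length_eq_add_of_exact (f.baseChange (Localization.AtPrime q))
    (g.baseChange (Localization.AtPrime q))
    (Module.Flat.lTensor_preserves_injective_linearMap f hf)
    (LinearMap.lTensor_surjective _ hg) (lTensor_exact _ h hg)

theorem localLength_quotient_eq_add_sup {M : Type*} [AddCommGroup M] [Module R M]
    (K L : Submodule R M) : localLength q (M ⧸ L) =
      localLength q (K ⧸ L.submoduleOf K) + localLength q (M ⧸ K ⊔ L) := by
  let f : (K ⧸ L.submoduleOf K) →ₗ[R] M ⧸ L := Submodule.mapQ _ _ K.subtype le_rfl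
  have hf : Function.Injective f := by
    rw [← LinearMap.ker_eq_bot]
    exact (Submodule.ker_mapQ _ _ _ _).trans (Submodule.mkQ_map_self _)
  have hexact : Function.Exact f (Submodule.factor (le_sup_right : L ≤ K ⊔ L)) := by
    rw [LinearMap.exact_iff]
    refine (Submodule.ker_mapQ _ _ _ _).trans ?_
    rw [Submodule.comap_id, Submodule.map_sup, Submodule.mkQ_map_self, sup_bot_eq]
    exact ((Submodule.range_mapQ _ _ _ _).trans (by rw [Submodule.range_subtype])).symm
  exact localLength_eq_add_of_exact q hf (Submodule.factor_surjective le_sup_right) hexact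

theorem localLength_quotient (J : Ideal R) :
    localLength q (R ⧸ J) = Module.length (Localization.AtPrime q)
      (Localization.AtPrime q ⧸ J.map (algebraMap R (Localization.AtPrime q))) :=
  ((Algebra.TensorProduct.quotIdealMapEquivTensorQuot
    (Localization.AtPrime q) J).toLinearEquiv.length_eq).symm

theorem localLength_quotient_span_singleton (x : R) :
    localLength q (R ⧸ Ideal.span {x}) =
      Ring.ord (Localization.AtPrime q) (algebraMap R (Localization.AtPrime q) x) := by
  rw [localLength_quotient, Ideal.map_span, Set.image_singleton, Ring.ord]

theorem localLength_quotient_eq_zero_of_not_le {J : Ideal R} (hJ : ¬ J ≤ q) :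
    localLength q (R ⧸ J) = 0 := by
  obtain ⟨s, hsJ, hsq⟩ := SetLike.not_le_iff_exists.1 hJ
  have htop : J.map (algebraMap R (Localization.AtPrime q)) = ⊤ :=
    Ideal.eq_top_of_isUnit_mem _ (Ideal.mem_map_of_mem _ hsJ)
      (IsLocalization.map_units _ (⟨s, hsq⟩ : q.primeCompl))
  rw [localLength_quotient, htop, Module.length_eq_zero_iff]
  exact Ideal.Quotient.subsingleton_iff.2 rfl

theorem localLength_quotient_self : localLength q (R ⧸ q) = 1 := by
  rw [localLength_quotient, Localization.AtPrime.map_eq_maximalIdeal, Module.length_eq_one_iff]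
  exact isSimpleModule_iff_isCoatom.2 (Ideal.isMaximal_def.1 (maximalIdeal.isMaximal _))

theorem localLength_quotient_range [IsDomain R] [IsPrincipalIdealRing (Localization.AtPrime q)]
    {F : Type*} [AddCommGroup F] [Module R F] [Module.Free R F] [Module.Finite R F]
    {g : F →ₗ[R] F} (hg : Function.Injective g) :
    localLength q (F ⧸ LinearMap.range g) =
      Ring.ord (Localization.AtPrime q)
        (algebraMap R (Localization.AtPrime q) (LinearMap.det g)) := by
  rw [← LinearMap.det_baseChange, ← length_quotient_range_eq_ord_det _
    (Module.Flat.lTensor_preserves_injective_linearMap g hg)]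
  have hex : Function.Exact (g.baseChange (Localization.AtPrime q))
      ((LinearMap.range g).mkQ.baseChange (Localization.AtPrime q)) :=
    lTensor_exact _ (LinearMap.exact_map_mkQ_range g) (Submodule.mkQ_surjective _)
  have hs : Function.Surjective ((LinearMap.range g).mkQ.baseChange (Localization.AtPrime q)) :=
    LinearMap.lTensor_surjective _ (Submodule.mkQ_surjective _)
  exact (((Submodule.quotEquivOfEq _ _ (LinearMap.exact_iff.1 hex).symm).trans
    (LinearMap.quotKerEquivOfSurjective _ hs)).length_eq).symm

end LocalLength

section ChernClass

instance (A : Type*) [CommRing A] (P : HeightOnePrime A) : P.1.IsPrime := P.2.1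

theorem ordAlong_eq_zero_iff {A : Type*} [CommRing A] {P : HeightOnePrime A} {x : A} :
    ordAlong P x = 0 ↔ x ∉ P.1 := by
  rw [ordAlong, Ring.ord, Module.length_eq_zero_iff, Ideal.Quotient.subsingleton_iff,
    Ideal.span_singleton_eq_top, IsLocalization.AtPrime.isUnit_to_map_iff _ P.1]
  rfl

theorem HeightOnePrime.not_le_of_ne {A : Type*} [CommRing A] {P Q : HeightOnePrime A}
    (h : P ≠ Q) : ¬ P.1 ≤ Q.1 := by
  intro hle
  have hlt := Ideal.height_add_one_le_of_lt_of_isPrime (hle.lt_of_ne (Subtype.coe_ne_coe.2 h))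
  rw [P.2.2, Q.2.2] at hlt
  norm_num at hlt

variable {R : Type*} [CommRing R] [IsDomain R]

theorem exists_free_submodule_forall_smul_mem (M : Type*) [AddCommGroup M] [Module R M] :
    ∃ N : Submodule R M, Module.Free R N ∧ ∀ m : M, ∃ c : R, c ≠ 0 ∧ c • m ∈ N := by
  obtain ⟨s, hs, h⟩ := exists_maximal_linearIndepOn R (id : M → M)
  refine ⟨Submodule.span R s, ?_, fun m ↦ ?_⟩
  · have hs : LinearIndependent R ((↑) : s → M) := hs
    have := Module.Free.of_basis (Module.Basis.span hs)
    rwa [Subtype.range_coe] at this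
  · by_cases hm : m ∈ s
    · exact ⟨1, one_ne_zero, by simpa using Submodule.subset_span hm⟩
    · simpa using h m hm

theorem exists_free_submodule_of_surjective {F M : Type*} [AddCommGroup F] [Module R F]
    [AddCommGroup M] [Module R M] {f : F →ₗ[R] M} (hf : Function.Surjective f)
    {N' : Submodule R (LinearMap.ker f)} [Module.Free R N']
    (hN' : ∀ k : LinearMap.ker f, ∃ c : R, c ≠ 0 ∧ c • k ∈ N') {N : Submodule R M}
    [Module.Free R N] (hN : ∀ m : M, ∃ c : R, c ≠ 0 ∧ c • m ∈ N) :
    ∃ L : Submodule R F, Module.Free R L ∧ (∀ v : F, ∃ c : R, c ≠ 0 ∧ c • v ∈ L) ∧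
      L.submoduleOf (LinearMap.ker f) = N' ∧ L.map f = N := by
  obtain ⟨s, hs⟩ := Module.projective_lifting_property f N.subtype hf
  have hs : ∀ x : N, f (s x) = x := LinearMap.congr_fun hs
  have hker : ∀ k : LinearMap.ker f, f k = 0 := fun k ↦ k.2
  let t : (N' × N) →ₗ[R] F := ((LinearMap.ker f).subtype ∘ₗ N'.subtype).coprod s
  have ht : ∀ x, t x = x.1 + s x.2 := fun _ ↦ rfl
  have hft : ∀ x, f (t x) = x.2 := fun x ↦ by rw [ht, map_add, hker, hs, zero_add]
  have hti : Function.Injective t := by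
    refine (injective_iff_map_eq_zero t).2 fun ⟨x, y⟩ hxy ↦ ?_
    have hy : y = 0 := Subtype.ext (by rw [← hft (x, y), hxy, map_zero]; rfl)
    have hx : x = 0 := by simpa [ht, hy] using hxy
    rw [hx, hy, Prod.mk_zero_zero]
  refine ⟨LinearMap.range t, .of_equiv (LinearEquiv.ofInjective t hti), fun v ↦ ?_, ?_, ?_⟩
  · obtain ⟨c, hc, hcv⟩ := hN (f v)
    obtain ⟨d, hd, hdw⟩ := hN' ⟨c • v - s ⟨_, hcv⟩, by simp [hs]⟩
    refine ⟨d * c, mul_ne_zero hd hc, (⟨_, hdw⟩, d • ⟨_, hcv⟩), ?_⟩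
    simp only [ht, map_smul s]
    simp [smul_sub, mul_smul]
  · ext k
    refine ⟨fun ⟨⟨x, y⟩, hxy⟩ ↦ ?_, fun hk ↦ ⟨(⟨k, hk⟩, 0), by simp [ht]⟩⟩
    have hxy : t (x, y) = k := hxy
    have hy : y = 0 := Subtype.ext (by rw [← hft (x, y), hxy, hker]; rfl)
    have hx : x.1 = k := Subtype.ext (by simpa [ht, hy] using hxy)
    exact hx ▸ x.2
  · ext m
    refine ⟨?_, fun hm ↦ ⟨s ⟨m, hm⟩, ⟨(0, ⟨m, hm⟩), by simp [ht]⟩, hs _⟩⟩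
    rintro ⟨_, ⟨x, rfl⟩, rfl⟩
    exact hft x ▸ x.2.2

/-- The first Chern class `∑ ℓ_P(M) [P]` of `M`, the sum being over the height one primes `P`, is
the divisor of the fraction `a / b`. -/
def HasPrincipalLength (R : Type*) [CommRing R] (M : Type*) [AddCommGroup M] [Module R M] : Prop :=
  ∃ a b : R, a ≠ 0 ∧ b ≠ 0 ∧
    ∀ P : HeightOnePrime R, localLength P.1 M + ordAlong P b = ordAlong P a

theorem ordAlong_mul (P : HeightOnePrime R) {x y : R} (hx : x ≠ 0) :
    ordAlong P (x * y) = ordAlong P x + ordAlong P y := by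
  rw [ordAlong, map_mul, Ring.ord_mul' _ (mem_nonZeroDivisors_of_ne_zero (by simpa using hx))]
  rfl

variable [IsNoetherianRing R]

theorem ordAlong_ne_top (P : HeightOnePrime R) {x : R} (hx : x ≠ 0) : ordAlong P x ≠ ⊤ := by
  have : Ring.KrullDimLE 1 (Localization.AtPrime P.1) :=
    Ring.krullDimLE_iff.2
      (by rw [IsLocalization.AtPrime.ringKrullDim_eq_height P.1, P.2.2, Nat.cast_one]; rfl)
  exact Ring.ord_ne_top (mem_nonZeroDivisors_of_ne_zero (by simpa using hx))

variable [IsIntegrallyClosed R]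

instance (P : HeightOnePrime R) : IsDiscreteValuationRing (Localization.AtPrime P.1) :=
  isDiscreteValuationRing_of_height_eq_one P.1 P.2.2 _

theorem exists_localLength_quotient_eq_ordAlong {F : Type*} [AddCommGroup F] [Module R F]
    [Module.Free R F] [Module.Finite R F] (N : Submodule R F) [Module.Free R N]
    (hN : ∀ m : F, ∃ c : R, c ≠ 0 ∧ c • m ∈ N) :
    ∃ a : R, a ≠ 0 ∧ ∀ P : HeightOnePrime R, localLength P.1 (F ⧸ N) = ordAlong P a := by
  have htor : Module.IsTorsion R (F ⧸ N) := by
    intro x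
    obtain ⟨m, rfl⟩ := Submodule.Quotient.mk_surjective _ x
    obtain ⟨c, hc, hcm⟩ := hN m
    exact ⟨⟨c, mem_nonZeroDivisors_of_ne_zero hc⟩, (Submodule.Quotient.mk_eq_zero _).2 hcm⟩
  have hrank : Module.finrank R F = Module.finrank R N := by
    rw [← Submodule.finrank_quotient_add_finrank N, htor.finrank_eq_zero, zero_add]
  let g : F →ₗ[R] F := N.subtype ∘ₗ (LinearEquiv.ofFinrankEq F N hrank).toLinearMap
  have hg : Function.Injective g := N.subtype_injective.comp (LinearEquiv.injective _)
  have hrange : LinearMap.range g = N := by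
    rw [LinearMap.range_comp, LinearEquiv.range, Submodule.map_top, Submodule.range_subtype]
  refine ⟨LinearMap.det g, fun h ↦ LinearMap.det_eq_zero_iff_ker_ne_bot.1 h
    (LinearMap.ker_eq_bot.2 hg), fun P ↦ ?_⟩
  rw [ordAlong, ← localLength_quotient_range P.1 hg, hrange]

theorem HasFreeResolutionLE.hasPrincipalLength {R : Type u} [CommRing R] [IsDomain R]
    [IsNoetherianRing R] [IsIntegrallyClosed R] {n : ℕ} : ∀ {M : Type u} [AddCommGroup M]
    [Module R M] [Module.Finite R M], HasFreeResolutionLE R n M → ∀ (N : Submodule R M)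
      [Module.Free R N], (∀ m : M, ∃ c : R, c ≠ 0 ∧ c • m ∈ N) → HasPrincipalLength R (M ⧸ N) := by
  induction n with
  | zero =>
    intro M _ _ _ hM N _ hN
    have : Module.Free R M := hM
    obtain ⟨a, ha, h⟩ := exists_localLength_quotient_eq_ordAlong N hN
    exact ⟨a, 1, ha, one_ne_zero, fun P ↦ by simp [h P, ordAlong]⟩
  | succ n ih =>
    rintro M _ _ _ ⟨m, f, hf, hK⟩ N _ hN
    obtain ⟨N', _, hN'⟩ := exists_free_submodule_forall_smul_mem (R := R) (LinearMap.ker f)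
    obtain ⟨a, b, ha, hb, hker⟩ := ih hK N' hN'
    obtain ⟨L, _, hL, rfl, rfl⟩ := exists_free_submodule_of_surjective hf hN' hN
    obtain ⟨a₀, ha₀, hfree⟩ := exists_localLength_quotient_eq_ordAlong L hL
    refine ⟨a₀ * b, a, mul_ne_zero ha₀ hb, ha, fun P ↦ ?_⟩
    have hsup : localLength P.1 ((Fin m → R) ⧸ LinearMap.ker f ⊔ L) =
        localLength P.1 (M ⧸ L.map f) :=
      localLength_congr P.1 ((Submodule.quotEquivOfEq _ _ (by
        rw [LinearMap.ker_comp, Submodule.ker_mkQ, Submodule.comap_map_eq, sup_comm])).trans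
        (((L.map f).mkQ ∘ₗ f).quotKerEquivOfSurjective ((Submodule.mkQ_surjective _).comp hf)))
    rw [ordAlong_mul P ha₀, ← hfree, localLength_quotient_eq_add_sup P.1 (LinearMap.ker f) L,
      hsup, ← hker P]
    ring

theorem dvd_iff_forall_ordAlong_le {x y : R} (hx : x ≠ 0) :
    x ∣ y ↔ ∀ P : HeightOnePrime R, ordAlong P x ≤ ordAlong P y := by
  have hdvd (P : HeightOnePrime R) : ordAlong P x ≤ ordAlong P y ↔
      algebraMap R (Localization.AtPrime P.1) x ∣ algebraMap R (Localization.AtPrime P.1) y := by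
    rw [ordAlong, ordAlong, Ring.ord_eq_addVal, Ring.ord_eq_addVal,
      IsDiscreteValuationRing.addVal_le_iff_dvd]
  refine ⟨fun h P ↦ (hdvd P).2 (map_dvd _ h), fun h ↦
    (dvd_iff_forall_height_eq_one hx).2 fun q hq hq1 ↦ ?_⟩
  obtain ⟨w, hw⟩ := (hdvd ⟨q, hq, hq1⟩).1 (h ⟨q, hq, hq1⟩)
  obtain ⟨w, s, rfl⟩ := IsLocalization.exists_mk'_eq q.primeCompl w
  refine ⟨s, s.2, w, FaithfulSMul.algebraMap_injective R (Localization.AtPrime q) ?_⟩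
  rw [map_mul, map_mul, hw, mul_left_comm, IsLocalization.mk'_spec']

theorem HeightOnePrime.eq_span_singleton {P : HeightOnePrime R} {c : R} (hc : c ≠ 0)
    (h : ∀ Q : HeightOnePrime R, ordAlong Q c = localLength Q.1 (R ⧸ P.1)) :
    P.1 = Ideal.span {c} := by
  refine le_antisymm (fun y hy ↦ ?_) ((Ideal.span_singleton_le_iff_mem _).2 ?_)
  · refine Ideal.mem_span_singleton.2 ((dvd_iff_forall_ordAlong_le hc).2 fun Q ↦ ?_)
    rw [h]
    obtain rfl | hPQ := eq_or_ne P Q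
    · rw [localLength_quotient_self, Order.one_le_iff_ne_zero, Ne, ordAlong_eq_zero_iff]
      exact not_not_intro hy
    · rw [localLength_quotient_eq_zero_of_not_le _ (not_le_of_ne hPQ)]
      exact zero_le
  · by_contra hcP
    rw [← ordAlong_eq_zero_iff, h, localLength_quotient_self] at hcP
    exact one_ne_zero hcP

theorem HeightOnePrime.isPrincipal_of_hasPrincipalLength {P : HeightOnePrime R} {x : R}
    (hx : x ∈ P.1) (hx0 : x ≠ 0)
    (h : HasPrincipalLength R (P.1 ⧸ (Ideal.span {x}).submoduleOf P.1)) : P.1.IsPrincipal := by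
  obtain ⟨a, b, ha, hb, h⟩ := h
  have hsup : P.1 ⊔ Ideal.span {x} = P.1 :=
    sup_eq_left.2 ((Ideal.span_singleton_le_iff_mem _).2 hx)
  have hord (Q : HeightOnePrime R) :
      ordAlong Q (x * b) = ordAlong Q a + localLength Q.1 (R ⧸ P.1) := by
    have hxQ : ordAlong Q x = localLength Q.1 (R ⧸ Ideal.span {x}) :=
      (localLength_quotient_span_singleton Q.1 x).symm
    rw [ordAlong_mul Q hx0, hxQ, localLength_quotient_eq_add_sup Q.1 P.1, hsup, ← h Q]
    ring
  obtain ⟨c, hc⟩ := (dvd_iff_forall_ordAlong_le ha).2 fun Q ↦ (hord Q).symm ▸ le_self_add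
  have hc0 : c ≠ 0 := right_ne_zero_of_mul (hc ▸ mul_ne_zero hx0 hb)
  refine ⟨c, eq_span_singleton hc0 fun Q ↦ ?_⟩
  have hQ := hord Q
  rw [hc, ordAlong_mul Q ha] at hQ
  exact ENat.add_right_injective_of_ne_top (ordAlong_ne_top Q ha) hQ

instance uniqueFactorizationMonoid_of_isRegularLocalRing (R : Type*) [CommRing R]
    [IsRegularLocalRing R] : UniqueFactorizationMonoid R := by
  refine UniqueFactorizationMonoid.of_forall_isPrincipal_of_height_eq_one fun p hp hp1 ↦ ?_
  obtain ⟨x, hx, hx0⟩ := p.ne_bot_iff.1 (p.ne_bot_of_height_eq_one hp1)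
  obtain ⟨n, hn⟩ := exists_forall_hasFreeResolutionLE (R := R)
  have hxp : (⟨x, hx⟩ : p) ≠ 0 := fun h ↦ hx0 (congrArg Subtype.val h)
  have hspan : (Ideal.span {x}).submoduleOf p = Submodule.span R {(⟨x, hx⟩ : p)} := by
    ext y
    rw [Submodule.mem_span_singleton]
    exact Ideal.mem_span_singleton'.trans (by simp [Subtype.ext_iff])
  have : Module.Free R ((Ideal.span {x}).submoduleOf p) :=
    hspan ▸ .of_equiv (LinearEquiv.toSpanNonzeroSingleton R p _ hxp)
  refine HeightOnePrime.isPrincipal_of_hasPrincipalLength (P := ⟨p, hp, hp1⟩) hx hx0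
    ((hn p).hasPrincipalLength _ fun m ↦ ⟨x, hx0, ?_⟩)
  exact Ideal.mem_span_singleton.2 (dvd_mul_right x m.1)

end ChernClass

section LocalGenerators

theorem exists_finset_card_le_spanFinrank_maximalIdeal {A : Type*} [CommRing A] [IsNoetherianRing A]
    (Q : Ideal A) [Q.IsPrime] : ∃ S : Finset A, (S : Set A) ⊆ Q ∧
      S.card ≤ (maximalIdeal (Localization.AtPrime Q)).spanFinrank ∧
      ∀ q ∈ Q, ∃ s ∉ Q, s * q ∈ Ideal.span (S : Set A) := by
  classical
  let L := Localization.AtPrime Q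
  obtain ⟨U, hU, hspan⟩ := Submodule.FG.exists_span_finset_card_eq_spanFinrank
    (maximalIdeal L).fg_of_isNoetherianRing
  have hnum (u : L) : ∃ b : A, ∃ s : Q.primeCompl, u * algebraMap A L s = algebraMap A L b :=
    let ⟨⟨b, s⟩, h⟩ := IsLocalization.surj Q.primeCompl u
    ⟨b, s, h⟩
  choose b s hb using hnum
  have hbQ : ((U.image b : Finset A) : Set A) ⊆ Q := by
    intro a ha
    obtain ⟨u, hu, rfl⟩ := Finset.mem_image.1 ha
    rw [SetLike.mem_coe, ← IsLocalization.AtPrime.to_map_mem_maximal_iff L Q, ← hb]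
    exact Ideal.mul_mem_right _ _ (hspan ▸ Submodule.subset_span hu)
  have hle : maximalIdeal L ≤
      (Ideal.span ((U.image b : Finset A) : Set A)).map (algebraMap A L) := by
    refine hspan.ge.trans (Submodule.span_le.2 fun u hu ↦ ?_)
    rw [SetLike.mem_coe, ← Ideal.mul_unit_mem_iff_mem _ (IsLocalization.map_units L (s u)), hb]
    exact Ideal.mem_map_of_mem _ (Ideal.subset_span (Finset.mem_image_of_mem b hu))
  refine ⟨U.image b, hbQ, hU ▸ Finset.card_image_le, fun q hq ↦ ?_⟩
  exact (IsLocalization.algebraMap_mem_map_algebraMap_iff Q.primeCompl L _ q).1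
    (hle ((IsLocalization.AtPrime.to_map_mem_maximal_iff L Q q).2 hq))

theorem exists_finset_card_le_height {A : Type*} [CommRing A] [IsRegularRing A] (Q : Ideal A)
    [Q.IsPrime] : ∃ S : Finset A, (S : Set A) ⊆ Q ∧ (S.card : ℕ∞) ≤ Q.height ∧
      ∀ q ∈ Q, ∃ s ∉ Q, s * q ∈ Ideal.span (S : Set A) := by
  obtain ⟨S, hSQ, hS, hgen⟩ := exists_finset_card_le_spanFinrank_maximalIdeal Q
  refine ⟨S, hSQ, ?_, hgen⟩
  rw [← WithBot.coe_le_coe, ← IsLocalization.AtPrime.ringKrullDim_eq_height Q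
    (Localization.AtPrime Q), ← IsRegularLocalRing.spanFinrank_maximalIdeal]
  exact_mod_cast hS

variable {R : Type*} [CommRing R] [IsLocalRing R] {ι : Type*}

instance isRegularRing_mvPolynomial_quotient_map_C [Finite ι] :
    IsRegularRing (MvPolynomial ι R ⧸ (maximalIdeal R).map (MvPolynomial.C (σ := ι))) :=
  haveI : IsRegularRing (R ⧸ maximalIdeal R) :=
    letI := Ideal.Quotient.field (maximalIdeal R)
    inferInstance
  IsRegularRing.of_ringEquiv
    (MvPolynomial.quotientEquivQuotientMvPolynomial (σ := ι) (maximalIdeal R)).toRingEquiv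

instance isPrime_map_mvPolynomialC {R : Type*} [CommRing R] (p : Ideal R) [p.IsPrime] :
    (p.map (MvPolynomial.C (σ := ι))).IsPrime := by
  rw [← Ideal.Quotient.isDomain_iff_prime]
  exact MulEquiv.isDomain _
    (MvPolynomial.quotientEquivQuotientMvPolynomial (σ := ι) p).symm.toMulEquiv

theorem exists_finset_height_add_card_le_height [IsNoetherianRing R] [Finite ι]
    {Q : Ideal (MvPolynomial ι R)} [Q.IsPrime] (hQ : Q.comap MvPolynomial.C = maximalIdeal R) :
    ∃ S : Finset (MvPolynomial ι R), (S : Set (MvPolynomial ι R)) ⊆ Q ∧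
      (maximalIdeal R).height + S.card ≤ Q.height ∧
      ∀ q ∈ Q, ∃ s ∉ Q, s * q ∈ (maximalIdeal R).map (MvPolynomial.C (σ := ι)) ⊔
        Ideal.span (S : Set (MvPolynomial ι R)) := by
  classical
  set J := (maximalIdeal R).map (MvPolynomial.C (σ := ι))
  have hJQ : J ≤ Q := Ideal.map_le_iff_le_comap.2 hQ.ge
  have : Q.LiesOver (maximalIdeal R) := ⟨hQ.symm⟩
  have hheight : Q.height = (maximalIdeal R).height + (Q.map (Ideal.Quotient.mk J)).height :=
    Ideal.height_eq_height_add_of_liesOver_of_hasGoingDown (maximalIdeal R) Q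
  have hprime : (Q.map (Ideal.Quotient.mk J)).IsPrime :=
    Ideal.map_isPrime_of_surjective Ideal.Quotient.mk_surjective (by rwa [Ideal.mk_ker])
  have hmem (a) : Ideal.Quotient.mk J a ∈ Q.map (Ideal.Quotient.mk J) ↔ a ∈ Q := by
    rw [← Ideal.mem_comap, Ideal.comap_map_of_surjective' _ Ideal.Quotient.mk_surjective,
      Ideal.mk_ker, sup_eq_left.2 hJQ]
  obtain ⟨S, hSQ, hcard, hgen⟩ := exists_finset_card_le_height (Q.map (Ideal.Quotient.mk J))
  let l : MvPolynomial ι R ⧸ J → MvPolynomial ι R := Function.surjInv Ideal.Quotient.mk_surjective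
  have hl : ∀ a, Ideal.Quotient.mk J (l a) = a := Function.surjInv_eq _
  have hspan : Ideal.span (S : Set (MvPolynomial ι R ⧸ J)) =
      (Ideal.span (l '' S)).map (Ideal.Quotient.mk J) := by
    rw [Ideal.map_span, Set.image_image]
    simp only [hl, Set.image_id']
  refine ⟨S.image l, ?_, ?_, fun q hq ↦ ?_⟩
  · rw [Finset.coe_image, Set.image_subset_iff]
    exact fun u hu ↦ (hmem _).1 ((hl u).symm ▸ hSQ hu)
  · rw [hheight]
    gcongr
    exact (Nat.cast_le.2 Finset.card_image_le).trans hcard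
  · obtain ⟨s, hs, hsq⟩ := hgen _ ((hmem q).2 hq)
    obtain ⟨s, rfl⟩ := Ideal.Quotient.mk_surjective s
    rw [hspan, ← map_mul, ← Ideal.mem_comap,
      Ideal.comap_map_of_surjective' _ Ideal.Quotient.mk_surjective, Ideal.mk_ker, sup_comm] at hsq
    exact ⟨s, fun h ↦ hs ((hmem s).2 h), by rwa [Finset.coe_image]⟩

theorem spanFinrank_span_range_le {R M : Type*} [Ring R] [AddCommGroup M] [Module R M] [Fintype ι]
    (f : ι → M) : (Submodule.span R (Set.range f)).spanFinrank ≤ Fintype.card ι := by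
  classical
  rw [← Set.image_univ, ← Finset.coe_univ, ← Finset.coe_image]
  exact (Submodule.spanFinrank_span_le_ncard_of_finite (Finset.finite_toSet _)).trans
    ((Set.ncard_coe_finset _).trans_le Finset.card_image_le)

theorem ringKrullDim_le_ringKrullDim_quotient_span_range_add_card [IsNoetherianRing R] [Fintype ι]
    (f : ι → R) (hf : Ideal.span (Set.range f) ≤ maximalIdeal R) :
    ringKrullDim R ≤ ringKrullDim (R ⧸ Ideal.span (Set.range f)) + (Fintype.card ι : ℕ) := by
  refine (ringKrullDim_le_ringKrullDim_quotient_add_spanFinrank (Ideal.span (Set.range f))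
    (hf.trans_eq (ringJacobson_eq_maximalIdeal R).symm)).trans ?_
  gcongr
  exact spanFinrank_span_range_le f

end LocalGenerators

section BlowupChart

open MvPolynomial

/-- `T` is a localization of the chart `R[𝔪/x]` of the blowup of the maximal ideal `𝔪` of the
local ring `R`, where `x` and the `g i` form a minimal system of generators of `𝔪` and
`t i = g i / x`. -/
structure IsBlowupChart {R T : Type*} [CommRing R] [IsLocalRing R] [CommRing T] [IsLocalRing T]
    [Algebra R T] {ι : Type*} [Fintype ι] (x : R) (g : ι → R) (t : ι → T) : Prop where
  injective : Function.Injective (algebraMap R T)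
  isLocalHom : IsLocalHom (algebraMap R T)
  span_eq : Ideal.span (insert x (Set.range g)) = maximalIdeal R
  card_add_one : Fintype.card ι + 1 = (maximalIdeal R).spanFinrank
  mul_eq : ∀ i, algebraMap R T x * t i = algebraMap R T (g i)
  exists_mul_eq : ∀ u : T, ∃ f s : MvPolynomial ι R, IsUnit (aeval t s) ∧
    u * aeval t s = aeval t f

namespace IsBlowupChart

section Presentation

/-- The prime of the polynomial ring over which the chart `T` lies. -/
noncomputable def center (R : Type*) {T ι : Type*} [CommRing R] [CommRing T] [IsLocalRing T]
    [Algebra R T] (t : ι → T) : Ideal (MvPolynomial ι R) :=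
  (maximalIdeal T).comap (aeval t : MvPolynomial ι R →ₐ[R] T)

/-- The ideal of the obvious relations `x * t i = g i` between the generators of the chart. -/
noncomputable def relations {R ι : Type*} [CommRing R] (x : R) (g : ι → R) :
    Ideal (MvPolynomial ι R) :=
  Ideal.span (Set.range fun i ↦ C x * X i - C (g i))

variable {R T : Type*} [CommRing R] [CommRing T] [IsLocalRing T] [Algebra R T] {ι : Type*} {x : R}
  {g : ι → R} {t : ι → T}

instance : (center R t).IsPrime := by unfold center; infer_instance

/-- The local ring presented by the obvious relations of the chart `T`, which turns out to be
`T` itself. -/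
abbrev Presentation (x : R) (g : ι → R) (t : ι → T) :=
  Localization.AtPrime (center R t) ⧸
    (relations x g).map (algebraMap _ (Localization.AtPrime (center R t)))

theorem mem_center {f : MvPolynomial ι R} : f ∈ center R t ↔ ¬ IsUnit (aeval t f : T) := by
  simp [center]

theorem algebraMap_presentation_eq_zero_iff {f : MvPolynomial ι R} :
    algebraMap (MvPolynomial ι R) (Presentation x g t) f = 0 ↔
      ∃ s ∉ center R t, s * f ∈ relations x g :=
  Ideal.Quotient.eq_zero_iff_mem.trans
    (IsLocalization.algebraMap_mem_map_algebraMap_iff (center R t).primeCompl _ _ f)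

theorem isUnit_algebraMap_presentation {f : MvPolynomial ι R} (hf : f ∉ center R t) :
    IsUnit (algebraMap (MvPolynomial ι R) (Presentation x g t) f) :=
  (IsLocalization.map_units (Localization.AtPrime (center R t))
    (⟨f, hf⟩ : (center R t).primeCompl)).map (Ideal.Quotient.mk _)

theorem maximalIdeal_presentation_eq_map [IsLocalRing (Presentation x g t)] :
    maximalIdeal (Presentation x g t) =
      (center R t).map (algebraMap (MvPolynomial ι R) (Presentation x g t)) := by
  rw [← map_maximalIdeal_of_surjective (Ideal.Quotient.mk _) Ideal.Quotient.mk_surjective,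
    ← Localization.AtPrime.map_eq_maximalIdeal, Ideal.map_map]
  rfl

theorem exists_pow_mul_sub_mem_relations {R : Type*} [CommRing R] (x : R) (g : ι → R)
    (f : MvPolynomial ι R) : ∃ N : ℕ, ∃ r : R, C x ^ N * f - C r ∈ relations x g := by
  induction f using MvPolynomial.induction_on with
  | C a => exact ⟨0, a, by simp⟩
  | add p q hp hq =>
    obtain ⟨n, r, h⟩ := hp
    obtain ⟨m, s, h'⟩ := hq
    refine ⟨n + m, x ^ m * r + x ^ n * s, ?_⟩
    have hsum : C x ^ (n + m) * (p + q) - C (x ^ m * r + x ^ n * s) =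
        C x ^ m * (C x ^ n * p - C r) + C x ^ n * (C x ^ m * q - C s) := by
      simp only [C_add, C_mul, C_pow]; ring
    rw [hsum]
    exact add_mem (Ideal.mul_mem_left _ _ h) (Ideal.mul_mem_left _ _ h')
  | mul_X p i hp =>
    obtain ⟨n, r, h⟩ := hp
    refine ⟨n + 1, r * g i, ?_⟩
    have hmul : C x ^ (n + 1) * (p * X i) - C (r * g i) =
        C x * X i * (C x ^ n * p - C r) + C r * (C x * X i - C (g i)) := by
      simp only [C_mul]; ring
    rw [hmul]
    exact add_mem (Ideal.mul_mem_left _ _ h) (Ideal.mul_mem_left _ _ (Ideal.subset_span ⟨i, rfl⟩))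

end Presentation

section LocalRing

variable {R T : Type*} [CommRing R] [IsLocalRing R] [CommRing T] [IsLocalRing T] [Algebra R T]
  {ι : Type*} [Fintype ι] {x : R} {g : ι → R} {t : ι → T}

theorem comap_C_center (h : IsBlowupChart x g t) : (center R t).comap C = maximalIdeal R := by
  have := h.isLocalHom
  ext r
  rw [Ideal.mem_comap, mem_center, mem_maximalIdeal, mem_nonunits_iff, ← algebraMap_eq,
    AlgHom.commutes, isUnit_map_iff]

theorem mem_maximalIdeal (h : IsBlowupChart x g t) : x ∈ maximalIdeal R :=
  h.span_eq ▸ Ideal.subset_span (Set.mem_insert _ _)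

theorem apply_mem_maximalIdeal (h : IsBlowupChart x g t) (i : ι) : g i ∈ maximalIdeal R :=
  h.span_eq ▸ Ideal.subset_span (Set.mem_insert_of_mem _ ⟨i, rfl⟩)

theorem map_C_le_center (h : IsBlowupChart x g t) : (maximalIdeal R).map C ≤ center R t :=
  Ideal.map_le_iff_le_comap.2 h.comap_C_center.ge

theorem relations_le_map_C (h : IsBlowupChart x g t) : relations x g ≤ (maximalIdeal R).map C := by
  refine Ideal.span_le.2 ?_
  rintro _ ⟨i, rfl⟩
  exact sub_mem (Ideal.mul_mem_right _ _ (Ideal.mem_map_of_mem _ h.mem_maximalIdeal))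
    (Ideal.mem_map_of_mem _ (h.apply_mem_maximalIdeal i))

theorem relations_le_ker_aeval (h : IsBlowupChart x g t) :
    relations x g ≤ RingHom.ker (aeval t : MvPolynomial ι R →ₐ[R] T) := by
  refine Ideal.span_le.2 ?_
  rintro _ ⟨i, rfl⟩
  simp [h.mul_eq]

theorem map_C_le_span_C_sup_relations (h : IsBlowupChart x g t) :
    (maximalIdeal R).map (C (σ := ι)) ≤ Ideal.span {C x} ⊔ relations x g := by
  have hCx : C x ∈ Ideal.span {C x} ⊔ relations x g :=
    Ideal.mem_sup_left (Ideal.mem_span_singleton_self _)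
  rw [← h.span_eq, Ideal.map_span, Ideal.span_le]
  rintro _ ⟨_, rfl | ⟨i, rfl⟩, rfl⟩
  · exact hCx
  · rw [SetLike.mem_coe, ← sub_sub_cancel (C x * X i) (C (g i))]
    exact sub_mem (Ideal.mul_mem_right _ _ hCx) (Ideal.mem_sup_right (Ideal.subset_span ⟨i, rfl⟩))

theorem dvd_aeval_of_mem_map_C (h : IsBlowupChart x g t) {f : MvPolynomial ι R}
    (hf : f ∈ (maximalIdeal R).map C) : algebraMap R T x ∣ aeval t f := by
  obtain ⟨a, ha, b, hb, rfl⟩ := Submodule.mem_sup.1 (h.map_C_le_span_C_sup_relations hf)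
  obtain ⟨c, rfl⟩ := Ideal.mem_span_singleton'.1 ha
  rw [map_add, RingHom.mem_ker.1 (h.relations_le_ker_aeval hb), add_zero, map_mul, aeval_C]
  exact dvd_mul_left _ _

theorem map_relations_le_maximalIdeal (h : IsBlowupChart x g t) :
    (relations x g).map (algebraMap _ (Localization.AtPrime (center R t))) ≤
      maximalIdeal (Localization.AtPrime (center R t)) :=
  (Ideal.map_mono (h.relations_le_map_C.trans h.map_C_le_center)).trans_eq
    (Localization.AtPrime.map_eq_maximalIdeal)

theorem maximalIdeal_presentation_eq_span (h : IsBlowupChart x g t)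
    [IsLocalRing (Presentation x g t)] {S : Set (MvPolynomial ι R)} (hS : S ⊆ center R t)
    (hgen : ∀ q ∈ center R t, ∃ s ∉ center R t,
      s * q ∈ (maximalIdeal R).map (C (σ := ι)) ⊔ Ideal.span S) :
    maximalIdeal (Presentation x g t) =
      Ideal.span (algebraMap (MvPolynomial ι R) (Presentation x g t) '' insert (C x) S) := by
  have hCx : C x ∈ center R t := h.map_C_le_center (Ideal.mem_map_of_mem _ h.mem_maximalIdeal)
  rw [maximalIdeal_presentation_eq_map]
  refine le_antisymm (Ideal.map_le_iff_le_comap.2 fun q hq ↦ ?_)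
    (Ideal.span_mono (Set.image_mono (Set.insert_subset hCx hS)))
  obtain ⟨s, hs, hsq⟩ := hgen q hq
  rw [Ideal.mem_comap, ← Ideal.unit_mul_mem_iff_mem _ (isUnit_algebraMap_presentation hs),
    ← map_mul, ← Ideal.mem_comap]
  refine (sup_le (h.map_C_le_span_C_sup_relations.trans (sup_le ?_ fun f hf ↦ ?_)) ?_) hsq
  · exact (Ideal.span_singleton_le_iff_mem _).2 (Ideal.subset_span ⟨_, Set.mem_insert _ _, rfl⟩)
  · rw [Ideal.mem_comap, algebraMap_presentation_eq_zero_iff.2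
      ⟨1, (Ideal.ne_top_iff_one _).1 Ideal.IsPrime.ne_top', by rwa [one_mul]⟩]
    exact zero_mem _
  · exact Ideal.span_le.2 fun f hf ↦ Ideal.subset_span ⟨f, Set.mem_insert_of_mem _ hf, rfl⟩

end LocalRing

section RegularLocalRing

variable {R T : Type*} [CommRing R] [IsRegularLocalRing R] [CommRing T] [IsLocalRing T]
  [Algebra R T] {ι : Type*} [Fintype ι] {x : R} {g : ι → R} {t : ι → T}

theorem add_one_le_ringKrullDim_presentation (h : IsBlowupChart x g t) {n : ℕ}
    (hn : (maximalIdeal R).height + n ≤ (center R t).height) :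
    (n + 1 : ℕ) ≤ ringKrullDim (Presentation x g t) := by
  have : IsLocalRing (Presentation x g t) :=
    isLocalRing_quotient_of_le_maximalIdeal h.map_relations_le_maximalIdeal
  have hle : ringKrullDim (Localization.AtPrime (center R t)) ≤
      ringKrullDim (Presentation x g t) + (Fintype.card ι : ℕ) := by
    have hrel := h.map_relations_le_maximalIdeal
    unfold Presentation
    unfold relations at hrel ⊢
    rw [Ideal.map_span, ← Set.range_comp] at hrel ⊢
    exact ringKrullDim_le_ringKrullDim_quotient_span_range_add_card _ hrel
  have hheight : (maximalIdeal R).height = (Fintype.card ι : ℕ) + 1 := by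
    rw [← WithBot.coe_inj, maximalIdeal_height_eq_ringKrullDim,
      ← IsRegularLocalRing.spanFinrank_maximalIdeal, ← h.card_add_one]
    norm_cast
  rw [IsLocalization.AtPrime.ringKrullDim_eq_height (center R t)] at hle
  rw [hheight] at hn
  obtain ⟨d, hd⟩ : ∃ d : ℕ∞, ringKrullDim (Presentation x g t) = d :=
    ⟨_, (maximalIdeal_height_eq_ringKrullDim (R := Presentation x g t)).symm⟩
  rw [hd] at hle ⊢
  have hadd : ((n + 1 : ℕ) : ℕ∞) + (Fintype.card ι : ℕ) ≤ d + (Fintype.card ι : ℕ) :=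
    calc ((n + 1 : ℕ) : ℕ∞) + (Fintype.card ι : ℕ) = (Fintype.card ι : ℕ) + 1 + n := by
          push_cast; ring
      _ ≤ _ := hn.trans (by exact_mod_cast hle)
  exact_mod_cast (ENat.add_le_add_iff_right (ENat.natCast_ne_top _)).1 hadd

theorem isRegularLocalRing_presentation (h : IsBlowupChart x g t) :
    IsRegularLocalRing (Presentation x g t) ∧
      algebraMap (MvPolynomial ι R) (Presentation x g t) (C x) ≠ 0 := by
  have : IsLocalRing (Presentation x g t) :=
    isLocalRing_quotient_of_le_maximalIdeal h.map_relations_le_maximalIdeal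
  obtain ⟨S, hSQ, hcard, hgen⟩ := exists_finset_height_add_card_le_height h.comap_C_center
  have hdim := h.add_one_le_ringKrullDim_presentation hcard
  let θ := algebraMap (MvPolynomial ι R) (Presentation x g t)
  have hspan : maximalIdeal (Presentation x g t) = Ideal.span (insert (θ (C x)) (θ '' S)) :=
    (h.maximalIdeal_presentation_eq_span hSQ hgen).trans (by rw [Set.image_insert_eq])
  have hfin : (θ '' (S : Set (MvPolynomial ι R))).Finite := S.finite_toSet.image θ
  have hcardS : (θ '' (S : Set (MvPolynomial ι R))).ncard ≤ S.card :=
    (Set.ncard_image_le S.finite_toSet).trans_eq (Set.ncard_coe_finset S)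
  have hrank : (maximalIdeal (Presentation x g t)).spanFinrank ≤ S.card + 1 :=
    hspan ▸ (Submodule.spanFinrank_span_le_ncard_of_finite (hfin.insert _)).trans
      ((Set.ncard_insert_le _ _).trans (Nat.succ_le_succ hcardS))
  have hreg : IsRegularLocalRing (Presentation x g t) :=
    .of_spanFinrank_maximalIdeal_le _ ((Nat.cast_le.2 hrank).trans hdim)
  refine ⟨hreg, fun hx ↦ ?_⟩
  have hx : θ (C x) = 0 := hx
  have hdim : S.card + 1 ≤ (maximalIdeal (Presentation x g t)).spanFinrank := by
    exact_mod_cast hdim.trans_eq hreg.spanFinrank_maximalIdeal.symm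
  rw [hspan, hx, Ideal.span_insert_zero] at hdim
  exact absurd (hdim.trans ((Submodule.spanFinrank_span_le_ncard_of_finite hfin).trans hcardS))
    (Nat.not_succ_le_self _)

theorem aeval_eq_zero_iff (h : IsBlowupChart x g t) {f : MvPolynomial ι R} :
    (aeval t f : T) = 0 ↔ algebraMap (MvPolynomial ι R) (Presentation x g t) f = 0 := by
  constructor
  · intro hf
    obtain ⟨hreg, hx⟩ := h.isRegularLocalRing_presentation
    have : IsDomain (Presentation x g t) := @isDomain_of_isRegularLocalRing _ _ hreg
    obtain ⟨N, r, hr⟩ := exists_pow_mul_sub_mem_relations x g f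
    have hr0 : algebraMap R T r = 0 := by
      simpa [hf, neg_eq_zero] using RingHom.mem_ker.1 (h.relations_le_ker_aeval hr)
    rw [(map_eq_zero_iff _ h.injective).1 hr0, C_0, sub_zero] at hr
    have hpow : algebraMap (MvPolynomial ι R) (Presentation x g t) (C x ^ N * f) = 0 :=
      algebraMap_presentation_eq_zero_iff.2
        ⟨1, (Ideal.ne_top_iff_one _).1 Ideal.IsPrime.ne_top', by rwa [one_mul]⟩
    rw [map_mul, map_pow, mul_eq_zero] at hpow
    exact hpow.resolve_left (pow_ne_zero _ hx)
  · intro hf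
    obtain ⟨s, hs, hsf⟩ := algebraMap_presentation_eq_zero_iff.1 hf
    have hmul : aeval t s * aeval t f = 0 := by
      rw [← map_mul, RingHom.mem_ker.1 (h.relations_le_ker_aeval hsf)]
    exact (not_not.1 (mem_center.not.1 hs)).mul_right_eq_zero.1 hmul

theorem dvd_aeval_iff (h : IsBlowupChart x g t) {f : MvPolynomial ι R} :
    algebraMap R T x ∣ aeval t f ↔ f ∈ (maximalIdeal R).map C := by
  refine ⟨?_, h.dvd_aeval_of_mem_map_C⟩
  rintro ⟨u, hu⟩
  obtain ⟨f', s, hs, hs'⟩ := h.exists_mul_eq u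
  have hprime : ((maximalIdeal R).map (C (σ := ι))).IsPrime := inferInstance
  have hzero : (aeval t (s * f - C x * f') : T) = 0 := by
    rw [map_sub, map_mul, map_mul, hu, ← hs', aeval_C]
    ring
  obtain ⟨s', hs'', hrel⟩ := algebraMap_presentation_eq_zero_iff.1 (h.aeval_eq_zero_iff.1 hzero)
  have hsub : s * f - C x * f' ∈ (maximalIdeal R).map (C (σ := ι)) :=
    (hprime.mem_or_mem (h.relations_le_map_C hrel)).resolve_left
      fun h' ↦ hs'' (h.map_C_le_center h')
  have hsf : s * f ∈ (maximalIdeal R).map (C (σ := ι)) :=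
    (Submodule.sub_mem_iff_left _ (Ideal.mul_mem_right f' _
      (Ideal.mem_map_of_mem C h.mem_maximalIdeal))).1 hsub
  exact (hprime.mem_or_mem hsf).resolve_left fun h' ↦ mem_center.1 (h.map_C_le_center h') hs

theorem ne_zero (h : IsBlowupChart x g t) : x ≠ 0 := by
  rintro rfl
  have hspan := h.span_eq
  rw [Ideal.span_insert_zero] at hspan
  have hcard : (Ideal.span (Set.range g)).spanFinrank ≤ Fintype.card ι :=
    spanFinrank_span_range_le g
  rw [hspan, ← h.card_add_one] at hcard
  exact Nat.not_succ_le_self _ hcard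

theorem prime_algebraMap (h : IsBlowupChart x g t) : Prime (algebraMap R T x) := by
  have hprime : ((maximalIdeal R).map (C (σ := ι))).IsPrime := inferInstance
  have := h.isLocalHom
  refine ⟨(map_ne_zero_iff _ h.injective).2 h.ne_zero,
    (isUnit_map_iff _ _).not.2 h.mem_maximalIdeal, fun a b hab ↦ ?_⟩
  obtain ⟨f, s, hs, hf⟩ := h.exists_mul_eq a
  obtain ⟨f', s', hs', hf'⟩ := h.exists_mul_eq b
  have hff' : algebraMap R T x ∣ aeval t (f * f') := by
    rw [map_mul, ← hf, ← hf']
    exact hab.trans ⟨aeval t s * aeval t s', by ring⟩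
  refine (hprime.mem_or_mem (h.dvd_aeval_iff.1 hff')).imp (fun hmem ↦ ?_) (fun hmem ↦ ?_)
  · rwa [← h.dvd_aeval_iff, ← hf, hs.dvd_mul_right] at hmem
  · rwa [← h.dvd_aeval_iff, ← hf', hs'.dvd_mul_right] at hmem

theorem nonempty_presentation_ringEquiv (h : IsBlowupChart x g t) :
    Nonempty (Presentation x g t ≃+* T) := by
  have hunit (s : (center R t).primeCompl) : IsUnit (aeval t s.1 : T) :=
    not_not.1 (mem_center.not.1 s.2)
  let ψ : Localization.AtPrime (center R t) →+* T :=
    IsLocalization.lift (M := (center R t).primeCompl) (g := (aeval t).toRingHom) hunit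
  have hker : RingHom.ker ψ = (relations x g).map (algebraMap _ _) := by
    ext a
    obtain ⟨f, s, rfl⟩ := IsLocalization.exists_mk'_eq (center R t).primeCompl a
    rw [RingHom.mem_ker, IsLocalization.mk'_mem_map_algebraMap_iff, IsLocalization.lift_mk'_spec,
      mul_zero]
    exact h.aeval_eq_zero_iff.trans algebraMap_presentation_eq_zero_iff
  have hsurj : Function.Surjective ψ := (IsLocalization.lift_surjective_iff _).2 fun u ↦
    let ⟨f, s, hs, hf⟩ := h.exists_mul_eq u
    ⟨(f, ⟨s, fun hmem ↦ mem_center.1 hmem hs⟩), hf⟩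
  exact ⟨(Ideal.quotEquivOfEq hker.symm).trans (RingHom.quotientKerEquivOfSurjective hsurj)⟩

theorem isRegularLocalRing (h : IsBlowupChart x g t) : IsRegularLocalRing T :=
  have := h.isRegularLocalRing_presentation.1
  .of_ringEquiv (R := Presentation x g t) h.nonempty_presentation_ringEquiv.some

end RegularLocalRing

section Order

variable {R T : Type*} [CommRing R] [IsLocalRing R] [CommRing T] [IsLocalRing T] [Algebra R T]
  {ι : Type*} [Fintype ι] {x : R} {g : ι → R} {t : ι → T}

theorem exists_pow_mul_aeval_eq (h : IsBlowupChart x g t) {n : ℕ} {y : R}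
    (hy : y ∈ maximalIdeal R ^ n) : ∃ f : MvPolynomial ι R, f.totalDegree ≤ n ∧
      algebraMap R T x ^ n * aeval t f = algebraMap R T y := by
  induction n generalizing y with
  | zero => exact ⟨C y, by simp, by simp⟩
  | succ n ih =>
    rw [pow_succ] at hy
    refine Submodule.mul_induction_on hy (fun a ha b hb ↦ ?_) ?_
    · obtain ⟨f, hf, hfa⟩ := ih ha
      rw [← h.span_eq] at hb
      induction hb using Submodule.span_induction with
      | mem b hb =>
        obtain rfl | ⟨i, rfl⟩ := hb
        · exact ⟨f, hf.trans n.le_succ, by rw [map_mul, ← hfa]; ring⟩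
        · refine ⟨f * X i, (totalDegree_mul _ _).trans (add_le_add hf (totalDegree_X i).le), ?_⟩
          rw [map_mul, map_mul, ← hfa, ← h.mul_eq, aeval_X]
          ring
      | zero => exact ⟨0, by simp, by simp⟩
      | add b c _ _ hb hc =>
        obtain ⟨p, hp, hpa⟩ := hb
        obtain ⟨q, hq, hqa⟩ := hc
        exact ⟨p + q, (totalDegree_add _ _).trans (max_le hp hq), by
          rw [mul_add a, map_add, map_add, ← hpa, ← hqa]; ring⟩
      | smul r b _ hb =>
        obtain ⟨p, hp, hpa⟩ := hb
        refine ⟨C r * p, (totalDegree_mul _ _).trans (by simpa using hp), ?_⟩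
        rw [smul_eq_mul, mul_left_comm, map_mul, map_mul, ← hpa, aeval_C]
        ring
    · rintro b c ⟨p, hp, hpa⟩ ⟨q, hq, hqa⟩
      exact ⟨p + q, (totalDegree_add _ _).trans (max_le hp hq), by
        rw [map_add, map_add, ← hpa, ← hqa]; ring⟩

theorem pow_mul_aeval_eq_algebraMap_sum (h : IsBlowupChart x g t) {n : ℕ} {f : MvPolynomial ι R}
    (hf : f.totalDegree ≤ n) : algebraMap R T x ^ n * aeval t f = algebraMap R T (∑ d ∈ f.support,
      coeff d f * (x ^ (n - d.degree) * ∏ i ∈ d.support, g i ^ d i)) := by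
  rw [aeval_def, eval₂_eq, Finset.mul_sum, map_sum]
  refine Finset.sum_congr rfl fun d hd ↦ ?_
  obtain ⟨k, rfl⟩ := Nat.exists_eq_add_of_le ((le_totalDegree hd).trans hf)
  have hmonomial : algebraMap R T x ^ d.degree * ∏ i ∈ d.support, t i ^ d i =
      algebraMap R T (∏ i ∈ d.support, g i ^ d i) := by
    rw [Finsupp.degree_apply, ← Finset.prod_pow_eq_pow_sum, ← Finset.prod_mul_distrib, map_prod]
    simp only [← mul_pow, h.mul_eq, map_pow]
  change algebraMap R T x ^ (d.degree + k) * _ = algebraMap R T (_ * (x ^ (d.degree + k - _) * _))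
  rw [map_mul, map_mul, ← hmonomial, map_pow, Nat.add_sub_cancel_left, pow_add]
  ring

theorem mem_pow_succ_of_mem_map_C (h : IsBlowupChart x g t) {n : ℕ} {y : R}
    {f : MvPolynomial ι R} (hf : f.totalDegree ≤ n) (hfm : f ∈ (maximalIdeal R).map C)
    (hy : algebraMap R T x ^ n * aeval t f = algebraMap R T y) :
    y ∈ maximalIdeal R ^ (n + 1) := by
  rw [h.injective (hy.symm.trans (h.pow_mul_aeval_eq_algebraMap_sum hf)), pow_succ']
  refine Ideal.sum_mem _ fun d hd ↦ Ideal.mul_mem_mul (mem_map_C_iff.1 hfm d) ?_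
  have hdn : d.degree ≤ n := (le_totalDegree hd).trans hf
  have hprod : ∏ i ∈ d.support, g i ^ d i ∈ maximalIdeal R ^ d.degree := by
    rw [Finsupp.degree_apply, ← Finset.prod_pow_eq_pow_sum]
    exact Ideal.prod_mem_prod fun i _ ↦ Ideal.pow_mem_pow (h.apply_mem_maximalIdeal i) _
  rw [← Nat.sub_add_cancel hdn, pow_add, Nat.add_sub_cancel]
  exact Ideal.mul_mem_mul (Ideal.pow_mem_pow h.mem_maximalIdeal _) hprod

end Order

theorem mem_pow_iff {R T : Type*} [CommRing R] [IsRegularLocalRing R] [CommRing T] [IsLocalRing T]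
    [Algebra R T] {ι : Type*} [Fintype ι] {x : R} {g : ι → R} {t : ι → T}
    (h : IsBlowupChart x g t) {n : ℕ} {y : R} :
    y ∈ maximalIdeal R ^ n ↔ algebraMap R T x ^ n ∣ algebraMap R T y := by
  refine ⟨fun hy ↦ let ⟨f, _, hf⟩ := h.exists_pow_mul_aeval_eq hy; ⟨_, hf.symm⟩, fun hy ↦ ?_⟩
  have := h.isRegularLocalRing
  induction n with
  | zero => simp
  | succ n ih =>
    obtain ⟨f, hdeg, hf⟩ := h.exists_pow_mul_aeval_eq (ih ((pow_dvd_pow _ n.le_succ).trans hy))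
    refine h.mem_pow_succ_of_mem_map_C hdeg (h.dvd_aeval_iff.1 ?_) hf
    rw [← hf, pow_succ] at hy
    exact (mul_dvd_mul_iff_left (pow_ne_zero _ h.prime_algebraMap.ne_zero)).1 hy

end IsBlowupChart

end BlowupChart

section LocalSubring

open LocalSubring

variable {K : Type*} [Field K]

theorem isUnit_iff_inv_mem {T : LocalSubring K} {s : T.toSubring} :
    IsUnit s ↔ (s : K) ≠ 0 ∧ (s : K)⁻¹ ∈ T.toSubring := by
  refine ⟨fun h ↦ ?_, fun ⟨h0, h⟩ ↦ .of_mul_eq_one ⟨_, h⟩ (Subtype.ext (mul_inv_cancel₀ h0))⟩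
  obtain ⟨r, hr⟩ := h.exists_right_inv
  have hsr : (s : K) * r = 1 := congrArg Subtype.val hr
  exact ⟨left_ne_zero_of_mul_eq_one hsr, inv_eq_of_mul_eq_one_right hsr ▸ r.2⟩

theorem le_iff_inv_mem {S T : LocalSubring K} : S ≤ T ↔ S.toSubring ≤ T.toSubring ∧
    ∀ s ∈ S.toSubring, s⁻¹ ∈ T.toSubring → s⁻¹ ∈ S.toSubring := by
  rw [le_def]
  refine ⟨fun ⟨h, hl⟩ ↦ ⟨h, fun s hs hs' ↦ ?_⟩, fun ⟨h, hi⟩ ↦ ⟨h, ⟨fun s hs ↦ ?_⟩⟩⟩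
  · obtain rfl | h0 := eq_or_ne s 0
    · rwa [inv_zero]
    · have hunit : IsUnit (Subring.inclusion h ⟨s, hs⟩) := isUnit_iff_inv_mem.2 ⟨h0, hs'⟩
      exact (isUnit_iff_inv_mem.1 (hl.map_nonunit _ hunit)).2
  · have hs' := isUnit_iff_inv_mem.1 hs
    exact isUnit_iff_inv_mem.2 ⟨hs'.1, hi _ s.2 hs'.2⟩

theorem eq_of_le_of_toSubring_le {S T : LocalSubring K} (h : S ≤ T)
    (h' : T.toSubring ≤ S.toSubring) : T = S :=
  toSubring_injective (le_antisymm h' h.1)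

theorem le_of_toSubring_le_of_le {S T V : LocalSubring K} (hST : S.toSubring ≤ T.toSubring)
    (hSV : S ≤ V) (hTV : T ≤ V) : S ≤ T :=
  le_iff_inv_mem.2 ⟨hST, fun s hs hs' ↦ (le_iff_inv_mem.1 hSV).2 s hs (hTV.1 hs')⟩

theorem mem_ofPrime_iff {A : Subring K} {P : Ideal A} [P.IsPrime] {z : K} :
    z ∈ (ofPrime A P).toSubring ↔ ∃ a s : A, s ∉ P ∧ z = a * (s : K)⁻¹ := by
  constructor
  · intro hz
    obtain ⟨⟨a, s⟩, h⟩ := IsLocalization.surj P.primeCompl (⟨z, hz⟩ : (ofPrime A P).toSubring)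
    have hzs : z * (s : A) = a := congrArg Subtype.val h
    have hs0 : ((s : A) : K) ≠ 0 := fun h0 ↦ s.2 ((Subtype.ext h0 : (s : A) = 0) ▸ zero_mem _)
    exact ⟨a, s, s.2, by rw [← hzs, mul_inv_cancel_right₀ hs0]⟩
  · rintro ⟨a, s, hs, rfl⟩
    have hunit : IsUnit (algebraMap A (ofPrime A P).toSubring s) :=
      IsLocalization.map_units _ (⟨s, hs⟩ : P.primeCompl)
    exact mul_mem (le_ofPrime A P a.2) (isUnit_iff_inv_mem.1 hunit).2

theorem inv_mem_ofPrime_iff {A : Subring K} {P : Ideal A} [P.IsPrime] {s : A} (h0 : s ≠ 0) :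
    (s : K)⁻¹ ∈ (ofPrime A P).toSubring ↔ s ∉ P := by
  change _ ↔ s ∈ P.primeCompl
  rw [← IsLocalization.AtPrime.isUnit_to_map_iff (ofPrime A P).toSubring P s, isUnit_iff_inv_mem]
  exact (and_iff_right (Subtype.coe_ne_coe.2 h0)).symm

theorem ofPrime_le_of_forall_inv_mem {A : Subring K} {P : Ideal A} [P.IsPrime] {B : Subring K}
    (hA : A ≤ B) (h : ∀ s : A, s ∉ P → (s : K)⁻¹ ∈ B) : (ofPrime A P).toSubring ≤ B := by
  intro z hz
  obtain ⟨a, s, hs, rfl⟩ := mem_ofPrime_iff.1 hz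
  exact mul_mem (hA a.2) (h s hs)

/-- The center on `A` of a local ring `V` containing `A`. -/
def centerIn (V : LocalSubring K) {A : Subring K} (hA : A ≤ V.toSubring) : Ideal A :=
  (maximalIdeal V.toSubring).comap (Subring.inclusion hA)

instance {V : LocalSubring K} {A : Subring K} (hA : A ≤ V.toSubring) : (centerIn V hA).IsPrime := by
  unfold centerIn; infer_instance

theorem notMem_centerIn_iff {V : LocalSubring K} {A : Subring K} (hA : A ≤ V.toSubring) {s : A} :
    s ∉ centerIn V hA ↔ (s : K) ≠ 0 ∧ (s : K)⁻¹ ∈ V.toSubring := by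
  rw [centerIn, Ideal.mem_comap, mem_maximalIdeal, mem_nonunits_iff, not_not, isUnit_iff_inv_mem]
  rfl

theorem ofPrime_centerIn_le {V : LocalSubring K} {A : Subring K} (hA : A ≤ V.toSubring) :
    ofPrime A (centerIn V hA) ≤ V := by
  refine le_iff_inv_mem.2 ⟨ofPrime_le_of_forall_inv_mem hA fun s hs ↦
    ((notMem_centerIn_iff hA).1 hs).2, fun z hz hz' ↦ ?_⟩
  obtain ⟨a, s, hs, rfl⟩ := mem_ofPrime_iff.1 hz
  obtain h0 | h0 := eq_or_ne (a : K) 0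
  · simp [h0]
  obtain ⟨hs0, hs'⟩ := (notMem_centerIn_iff hA).1 hs
  have ha : (a : K)⁻¹ ∈ V.toSubring := by
    rw [mul_inv, inv_inv] at hz'
    simpa only [mul_inv_cancel_right₀ hs0] using mul_mem hz' hs'
  rw [mul_inv, inv_inv, mul_comm]
  exact mem_ofPrime_iff.2 ⟨s, a, (notMem_centerIn_iff hA).2 ⟨h0, ha⟩, rfl⟩

theorem exists_mem_affineModel_le {A : Subring K} {V : LocalSubring K} (hA : A ≤ V.toSubring) :
    ∃ T ∈ affineModel A, T ≤ V :=
  ⟨_, ⟨centerIn V hA, inferInstance, rfl⟩, ofPrime_centerIn_le hA⟩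

theorem mem_affineModel_iff {A : Subring K} {T : LocalSubring K} :
    T ∈ affineModel A ↔ A ≤ T.toSubring ∧ ∀ z ∈ T.toSubring, ∃ a ∈ A, ∃ s ∈ A, s ≠ 0 ∧
      s⁻¹ ∈ T.toSubring ∧ z = a * s⁻¹ := by
  constructor
  · rintro ⟨P, hP, rfl⟩
    refine ⟨le_ofPrime A P, fun z hz ↦ ?_⟩
    obtain ⟨a, s, hs, rfl⟩ := mem_ofPrime_iff.1 hz
    have h0 : s ≠ 0 := ne_of_mem_of_not_mem (zero_mem P) hs |>.symm
    exact ⟨a, a.2, s, s.2, Subtype.coe_ne_coe.2 h0, (inv_mem_ofPrime_iff h0).2 hs, rfl⟩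
  · rintro ⟨hA, h⟩
    refine ⟨centerIn T hA, inferInstance,
      eq_of_le_of_toSubring_le (ofPrime_centerIn_le hA) fun z hz ↦ ?_⟩
    obtain ⟨a, ha, s, hs, h0, hi, rfl⟩ := h z hz
    exact mem_ofPrime_iff.2 ⟨⟨a, ha⟩, ⟨s, hs⟩, (notMem_centerIn_iff hA).2 ⟨h0, hi⟩, rfl⟩

theorem le_of_mem_affineModel_of_le {A : Subring K} {S T V : LocalSubring K}
    (hS : S ∈ affineModel A) (hA : A ≤ T.toSubring) (hSV : S ≤ V) (hTV : T ≤ V) : S ≤ T := by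
  refine le_of_toSubring_le_of_le (fun z hz ↦ ?_) hSV hTV
  obtain ⟨a, ha, s, hs, -, hsi, rfl⟩ := (mem_affineModel_iff.1 hS).2 z hz
  exact mul_mem (hA ha) ((le_iff_inv_mem.1 hTV).2 s (hA hs) (hSV.1 hsi))

theorem affineModel_trans {A : Subring K} {B W : LocalSubring K} (hB : B ∈ affineModel A)
    (hW : W ∈ affineModel B.toSubring) : W ∈ affineModel A := by
  rw [mem_affineModel_iff] at hB hW ⊢
  refine ⟨hB.1.trans hW.1, fun z hz ↦ ?_⟩
  obtain ⟨b, hb, c, hc, hc0, hci, rfl⟩ := hW.2 z hz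
  obtain ⟨a, ha, s, hs, hs0, hsi, rfl⟩ := hB.2 b hb
  obtain ⟨a', ha', s', hs', hs0', hsi', rfl⟩ := hB.2 c hc
  have ha0' : a' ≠ 0 := left_ne_zero_of_mul hc0
  refine ⟨a * s', mul_mem ha hs', s * a', mul_mem hs ha', mul_ne_zero hs0 ha0', ?_, ?_⟩
  · have hinv : (s * a')⁻¹ = s⁻¹ * s'⁻¹ * (a' * s'⁻¹)⁻¹ := by field_simp
    exact hinv ▸ mul_mem (mul_mem (hW.1 hsi) (hW.1 hsi')) hci
  · field_simp

end LocalSubring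

section BlowupOfSubring

variable {K : Type*} [Field K] {A : Subring K} {J : Ideal A} {a : A}

theorem div_mem_blowupChart {x : A} (hx : x ∈ J) : (x : K) / a ∈ blowupChart A J a :=
  Algebra.subset_adjoin ⟨x, hx, rfl⟩

theorem le_blowupChart (A : Subring K) (J : Ideal A) (a : A) : A ≤ blowupChart A J a :=
  fun z hz ↦ (Algebra.adjoin A {z : K | ∃ x ∈ J, z = (x : K) / (a : K)}).algebraMap_mem ⟨z, hz⟩

theorem blowupChart_le {B : Subring K} (hA : A ≤ B) (hJ : ∀ x ∈ J, (x : K) / a ∈ B) :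
    blowupChart A J a ≤ B := by
  intro z hz
  change z ∈ Algebra.adjoin A _ at hz
  induction hz using Algebra.adjoin_induction with
  | mem z hz => obtain ⟨x, hx, rfl⟩ := hz; exact hJ x hx
  | algebraMap r => exact hA r.2
  | add _ _ _ _ h1 h2 => exact add_mem h1 h2
  | mul _ _ _ _ h1 h2 => exact mul_mem h1 h2

theorem exists_mul_pow_mem_of_mem_blowupChart {B : Subring K} (hA : A ≤ B) {c : K} (hc : c ∈ B)
    (hJ : ∀ x ∈ J, (x : K) / a * c ∈ B) {z : K} (hz : z ∈ blowupChart A J a) :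
    ∃ n : ℕ, z * c ^ n ∈ B := by
  change z ∈ Algebra.adjoin A _ at hz
  induction hz using Algebra.adjoin_induction with
  | mem z hz => obtain ⟨x, hx, rfl⟩ := hz; exact ⟨1, by simpa using hJ x hx⟩
  | algebraMap r => exact ⟨0, by rw [pow_zero, mul_one]; exact hA r.2⟩
  | add y z _ _ hy hz =>
    obtain ⟨n, hn⟩ := hy
    obtain ⟨m, hm⟩ := hz
    have hadd : (y + z) * c ^ (n + m) = y * c ^ n * c ^ m + z * c ^ m * c ^ n := by ring
    exact ⟨n + m, hadd ▸ add_mem (mul_mem hn (pow_mem hc _)) (mul_mem hm (pow_mem hc _))⟩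
  | mul y z _ _ hy hz =>
    obtain ⟨n, hn⟩ := hy
    obtain ⟨m, hm⟩ := hz
    have hmul : y * z * c ^ (n + m) = y * c ^ n * (z * c ^ m) := by ring
    exact ⟨n + m, hmul ▸ mul_mem hn hm⟩

theorem div_mul_self_mem (ha : a ≠ 0) {x : A} : (x : K) / a * a ∈ A := by
  rw [div_mul_cancel₀ _ (Subtype.coe_ne_coe.2 ha)]
  exact x.2

theorem mem_affineModel_of_forall_div_mul_mem {B : Subring K} (hA : A ≤ B) {c : K} (hc : c ∈ B)
    (hc0 : c ≠ 0) (hJ : ∀ x ∈ J, (x : K) / a * c ∈ B) {W : LocalSubring K}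
    (hW : W ∈ affineModel (blowupChart A J a)) (hB : B ≤ W.toSubring) (hi : c⁻¹ ∈ W.toSubring) :
    W ∈ affineModel B := by
  rw [mem_affineModel_iff] at hW ⊢
  refine ⟨hB, fun z hz ↦ ?_⟩
  obtain ⟨α, hα, s, hs, hs0, hsi, rfl⟩ := hW.2 z hz
  obtain ⟨n, hn⟩ := exists_mul_pow_mem_of_mem_blowupChart hA hc hJ hα
  obtain ⟨m, hm⟩ := exists_mul_pow_mem_of_mem_blowupChart hA hc hJ hs
  refine ⟨α * c ^ n * c ^ m, mul_mem hn (pow_mem hc _), s * c ^ m * c ^ n,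
    mul_mem hm (pow_mem hc _), by positivity, ?_, by field_simp⟩
  rw [mul_inv, mul_inv, ← inv_pow, ← inv_pow]
  exact mul_mem (mul_mem hsi (pow_mem hi _)) (pow_mem hi _)

theorem mem_affineModel_of_inv_mem (ha : a ≠ 0) {W : LocalSubring K}
    (hW : W ∈ affineModel (blowupChart A J a)) (hi : (a : K)⁻¹ ∈ W.toSubring) :
    W ∈ affineModel A :=
  mem_affineModel_of_forall_div_mul_mem le_rfl a.2 (Subtype.coe_ne_coe.2 ha)
    (fun _ _ ↦ div_mul_self_mem ha) hW
    ((le_blowupChart A J a).trans (mem_affineModel_iff.1 hW).1) hi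

theorem mem_affineModel_blowupChart_of_div_mem {x : A} (hx : x ∈ J) (ha : a ∈ J) (hx0 : x ≠ 0)
    (ha0 : a ≠ 0) {T : LocalSubring K} (hT : T ∈ affineModel (blowupChart A J a))
    (hax : (a : K) / x ∈ T.toSubring) : T ∈ affineModel (blowupChart A J x) := by
  have ha0 : (a : K) ≠ 0 := Subtype.coe_ne_coe.2 ha0
  have hx0 : (x : K) ≠ 0 := Subtype.coe_ne_coe.2 hx0
  have hAT := (mem_affineModel_iff.1 hT).1
  refine mem_affineModel_of_forall_div_mul_mem (le_blowupChart A J x)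
    (div_mem_blowupChart ha) (div_ne_zero ha0 hx0) (fun u hu ↦ ?_) hT
    (blowupChart_le ((le_blowupChart A J a).trans hAT) fun u hu ↦ ?_)
    (by rw [inv_div]; exact hAT (div_mem_blowupChart hx))
  · rw [div_mul_div_cancel₀ ha0]
    exact div_mem_blowupChart hu
  · rw [← div_mul_div_cancel₀ ha0]
    exact mul_mem (hAT (div_mem_blowupChart hu)) hax

theorem exists_mem_associated_of_span_eq_span_singleton {B : Type*} [CommRing B] [IsLocalRing B]
    [IsDomain B] {X : Set B} {a : B} (ha : a ≠ 0) (h : Ideal.span X = Ideal.span {a}) :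
    ∃ b ∈ X, Associated b a := by
  by_contra! hcon
  have hle : Ideal.span X ≤ Ideal.span {a} * maximalIdeal B := by
    refine Ideal.span_le.2 fun x hx ↦ ?_
    obtain ⟨c, rfl⟩ := Ideal.mem_span_singleton.1 (h ▸ Ideal.subset_span hx)
    refine Ideal.mul_mem_mul (Ideal.mem_span_singleton_self a) ((mem_maximalIdeal c).2 fun hc ↦ ?_)
    exact hcon _ hx (associated_mul_unit_left a c hc)
  rw [h, Ideal.span_singleton_le_iff_mem, Ideal.mem_span_singleton_mul] at hle
  obtain ⟨c, hc, hac⟩ := hle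
  rw [mul_eq_left₀ ha] at hac
  exact one_notMem_nonunits (hac ▸ hc)

theorem exists_mem_div_mem_of_blowupChart_le {U : Set A} (hU : Ideal.span U = J) (ha : a ∈ J)
    (ha0 : a ≠ 0) {T : LocalSubring K} (hT : blowupChart A J a ≤ T.toSubring) :
    ∃ x ∈ U, x ≠ 0 ∧ (a : K) / x ∈ T.toSubring := by
  let φ : A →+* T.toSubring := Subring.inclusion ((le_blowupChart A J a).trans hT)
  have hφa : φ a ≠ 0 := (map_ne_zero_iff φ (Subring.inclusion_injective _)).2 ha0
  have hspan : Ideal.span (φ '' U) = Ideal.span {φ a} := by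
    refine le_antisymm (Ideal.span_le.2 ?_) ?_
    · rintro _ ⟨u, hu, rfl⟩
      exact Ideal.mem_span_singleton.2
        ⟨⟨u / a, hT (div_mem_blowupChart (hU ▸ Ideal.subset_span hu))⟩,
          Subtype.ext (mul_div_cancel₀ _ (Subtype.coe_ne_coe.2 ha0)).symm⟩
    · rw [← Ideal.map_span, hU, Ideal.span_singleton_le_iff_mem]
      exact Ideal.mem_map_of_mem φ ha
  obtain ⟨_, ⟨x, hx, rfl⟩, hassoc⟩ := exists_mem_associated_of_span_eq_span_singleton hφa hspan
  have hx0 : x ≠ 0 := fun hx0 ↦ (hassoc.ne_zero_iff.2 hφa) (by rw [hx0, map_zero])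
  obtain ⟨c, hc⟩ := hassoc.dvd
  refine ⟨x, hx, hx0, ?_⟩
  have hc : (a : K) = x * c := congrArg Subtype.val hc
  rw [hc, mul_div_cancel_left₀ _ (Subtype.coe_ne_coe.2 hx0)]
  exact c.2

theorem blowupChart_le_range_aeval {x : A} (hx0 : x ≠ 0) {ι : Type*} {g : ι → A}
    (hJ : Ideal.span (insert x (Set.range g)) = J) :
    blowupChart A J x ≤
      (MvPolynomial.aeval (R := A) fun i ↦ (g i : K) / x).range.toSubring := by
  have hx0 : (x : K) ≠ 0 := Subtype.coe_ne_coe.2 hx0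
  set B : Subalgebra A K := (MvPolynomial.aeval (R := A) fun i ↦ (g i : K) / x).range
  refine blowupChart_le (fun z hz ↦ B.algebraMap_mem ⟨z, hz⟩) fun u hu ↦ ?_
  have hle : J ≤ Submodule.comap ((LinearMap.mulRight A (x : K)⁻¹).comp (Algebra.linearMap A K))
      (Subalgebra.toSubmodule B) := by
    rw [← hJ]
    refine Ideal.span_le.2 (Set.insert_subset ?_ (Set.range_subset_iff.2 fun i ↦ ?_))
    · change (x : K) * (x : K)⁻¹ ∈ B
      rw [mul_inv_cancel₀ hx0]
      exact one_mem B
    · change (g i : K) * (x : K)⁻¹ ∈ B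
      exact ⟨MvPolynomial.X i, by simp [div_eq_mul_inv]⟩
  exact div_eq_mul_inv (u : K) x ▸ hle hu

theorem isBlowupChart_of_mem_affineModel [IsLocalRing A] {T : LocalSubring K}
    (hAT : A ≤ T.toSubring) [IsLocalHom (Subring.inclusion hAT)] {x : A} (hx0 : x ≠ 0)
    {ι : Type*} [Fintype ι] {g : ι → A}
    (hspan : Ideal.span (insert x (Set.range g)) = maximalIdeal A)
    (hcard : Fintype.card ι + 1 = (maximalIdeal A).spanFinrank)
    (hT : T ∈ affineModel (blowupChart A (maximalIdeal A) x)) :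
    letI := (Subring.inclusion hAT).toAlgebra
    ∃ t : ι → T.toSubring, IsBlowupChart x g t := by
  let := (Subring.inclusion hAT).toAlgebra
  have : IsScalarTower A T.toSubring K := .of_algebraMap_eq fun _ ↦ rfl
  obtain ⟨hle, hfrac⟩ := mem_affineModel_iff.1 hT
  let t : ι → T.toSubring := fun i ↦
    ⟨g i / x, hle (div_mem_blowupChart (hspan ▸ Ideal.subset_span (.inr ⟨i, rfl⟩)))⟩
  have haeval (f : MvPolynomial ι A) :
      MvPolynomial.aeval (fun i ↦ (g i : K) / x) f = (MvPolynomial.aeval t f : T.toSubring) :=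
    MvPolynomial.aeval_algebraMap_apply K t f
  refine ⟨t, Subring.inclusion_injective hAT, ‹_›, hspan, hcard, fun i ↦
    Subtype.ext (mul_div_cancel₀ _ (Subtype.coe_ne_coe.2 hx0)), fun u ↦ ?_⟩
  obtain ⟨α, hα, s, hs, hs0, hsi, hu⟩ := hfrac u u.2
  obtain ⟨p, rfl⟩ := blowupChart_le_range_aeval hx0 hspan hα
  obtain ⟨q, rfl⟩ := blowupChart_le_range_aeval hx0 hspan hs
  simp only [AlgHom.toRingHom_eq_coe, RingHom.coe_coe, haeval] at hs0 hsi hu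
  exact ⟨p, q, isUnit_iff_inv_mem.2 ⟨hs0, hsi⟩,
    Subtype.ext (by rw [Subring.coe_mul, hu, inv_mul_cancel_right₀ hs0])⟩

end BlowupOfSubring

section LocalQuadraticTransform

open LocalSubring

variable {K : Type*} [Field K] {S T : LocalSubring K}

theorem natCast_le_order_iff {x : S.toSubring} {n : ℕ} :
    (n : ℕ∞) ≤ order S x ↔ x ∈ maximalIdeal S.toSubring ^ n := by
  refine ⟨fun h ↦ ?_, fun h ↦
    le_iSup₂ (f := fun (n : ℕ) (_ : n ∈ {n | x ∈ maximalIdeal S.toSubring ^ n}) ↦ (n : ℕ∞)) n h⟩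
  cases n with
  | zero => simp
  | succ n =>
    have hlt : (n : ℕ∞) < order S x := (Nat.cast_lt.2 n.lt_succ_self).trans_le h
    simp only [order, lt_iSup_iff] at hlt
    obtain ⟨m, hm, hnm⟩ := hlt
    exact Ideal.pow_le_pow_right (Nat.cast_lt.1 hnm) hm

theorem order_le_order_iff {x y : S.toSubring} :
    order S y ≤ order S x ↔
      ∀ n : ℕ, y ∈ maximalIdeal S.toSubring ^ n → x ∈ maximalIdeal S.toSubring ^ n := by
  simp only [← natCast_le_order_iff]
  exact ENat.forall_natCast_le_iff_le.symm

/-- `x` is a local equation, at a point `T` dominating `S`, of the exceptional divisor of the blowup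
of the maximal ideal of `S`; the order function of `S` is then the order along this divisor. -/
structure IsExceptionalEquation (h : S.toSubring ≤ T.toSubring) (x : S.toSubring) : Prop where
  mem_affineModel : T ∈ affineModel (blowupChart S.toSubring (maximalIdeal S.toSubring) x)
  prime : Prime (Subring.inclusion h x)
  mem_pow_iff (n : ℕ) (y : S.toSubring) : y ∈ maximalIdeal S.toSubring ^ n ↔
    Subring.inclusion h x ^ n ∣ Subring.inclusion h y

theorem IsLocalQuadraticTransform.exists_isBlowupChart [IsRegularLocalRing S.toSubring]
    (h : IsLocalQuadraticTransform S T) : letI := (Subring.inclusion h.1.1).toAlgebra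
    ∃ x : S.toSubring, T ∈ affineModel (blowupChart S.toSubring (maximalIdeal S.toSubring) x) ∧
      ∃ (U : Finset S.toSubring) (t : U → T.toSubring), IsBlowupChart x Subtype.val t := by
  classical
  obtain ⟨⟨hST, hlocal⟩, a, ha, ha0, hT⟩ := h
  obtain ⟨U, hUcard, hU⟩ :=
    (IsNoetherian.noetherian (maximalIdeal S.toSubring)).exists_span_finset_card_eq_spanFinrank
  obtain ⟨x, hxU, hx0, hax⟩ :=
    exists_mem_div_mem_of_blowupChart_le hU ha ha0 (mem_affineModel_iff.1 hT).1
  have hspan : Ideal.span (insert x (Set.range (Subtype.val : U.erase x → S.toSubring))) =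
      maximalIdeal S.toSubring := by
    rw [Subtype.range_coe_subtype, Finset.setOfPred_mem, ← Finset.coe_insert,
      Finset.insert_erase hxU]
    exact hU
  have hcard : Fintype.card (U.erase x) + 1 = (maximalIdeal S.toSubring).spanFinrank := by
    rw [Fintype.card_coe, Finset.card_erase_add_one hxU, hUcard]
  have hTx := mem_affineModel_blowupChart_of_div_mem (hU ▸ Ideal.subset_span hxU) ha hx0 ha0 hT hax
  exact ⟨x, hTx, U.erase x,
    isBlowupChart_of_mem_affineModel hST hx0 hspan hcard hTx⟩

theorem IsLocalQuadraticTransform.isRegularLocalRing [IsRegularLocalRing S.toSubring]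
    (h : IsLocalQuadraticTransform S T) : IsRegularLocalRing T.toSubring := by
  let := (Subring.inclusion h.1.1).toAlgebra
  obtain ⟨x, -, U, t, hc⟩ := h.exists_isBlowupChart
  exact hc.isRegularLocalRing

theorem IsLocalQuadraticTransform.exists_isExceptionalEquation [IsRegularLocalRing S.toSubring]
    (h : IsLocalQuadraticTransform S T) : ∃ x, IsExceptionalEquation h.1.1 x := by
  let := (Subring.inclusion h.1.1).toAlgebra
  obtain ⟨x, hT, U, t, hc⟩ := h.exists_isBlowupChart
  exact ⟨x, hT, hc.prime_algebraMap, fun _ _ ↦ hc.mem_pow_iff⟩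

namespace IsExceptionalEquation

variable {h : S.toSubring ≤ T.toSubring} {x : S.toSubring}

theorem coe_ne_zero (hx : IsExceptionalEquation h x) : (x : K) ≠ 0 :=
  fun h0 ↦ hx.prime.ne_zero (Subtype.ext h0)

theorem ne_zero (hx : IsExceptionalEquation h x) : x ≠ 0 :=
  Subtype.coe_ne_coe.1 hx.coe_ne_zero

theorem div_mem_orderValuationRing (hx : IsExceptionalEquation h x) {y z : S.toSubring} {n : ℕ}
    {b c : T.toSubring} (hy : (y : K) = x ^ n * b) (hz : (z : K) = x ^ n * c)
    (hb : ¬ Subring.inclusion h x ∣ b) : (z : K) / y ∈ orderValuationRing S := by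
  replace hy : Subring.inclusion h y = Subring.inclusion h x ^ n * b := Subtype.ext hy
  replace hz : Subring.inclusion h z = Subring.inclusion h x ^ n * c := Subtype.ext hz
  refine ⟨z, y, fun hy0 ↦ hb ?_, order_le_order_iff.2 fun k hk ↦ ?_, rfl⟩
  · rw [hy0, map_zero, zero_eq_mul, or_iff_right (pow_ne_zero n hx.prime.ne_zero)] at hy
    exact hy ▸ dvd_zero _
  · rw [hx.mem_pow_iff, hy] at hk
    rw [hx.mem_pow_iff, hz]
    have hkn : k ≤ n := by
      by_contra! hnk
      have hdvd := (pow_dvd_pow _ hnk).trans hk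
      rw [pow_succ, mul_dvd_mul_iff_left (pow_ne_zero n hx.prime.ne_zero)] at hdvd
      exact hb hdvd
    exact (pow_dvd_pow _ hkn).mul_right c

theorem exists_notDvd_eq_div_of_mem_orderValuationRing [IsNoetherianRing T.toSubring]
    (hx : IsExceptionalEquation h x) {z : K} (hz : z ∈ orderValuationRing S) :
    ∃ c b : T.toSubring, ¬ Subring.inclusion h x ∣ b ∧ z = (c : K) * (b : K)⁻¹ := by
  obtain ⟨u, y, hy0, huy, rfl⟩ := hz
  have hy0' : Subring.inclusion h y ≠ 0 :=
    (map_ne_zero_iff _ (Subring.inclusion_injective h)).2 hy0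
  obtain ⟨b, hb, hndvd⟩ :=
    (FiniteMultiplicity.of_prime_left hx.prime hy0').exists_eq_pow_mul_and_not_dvd
  obtain ⟨c, hc⟩ := (hx.mem_pow_iff _ u).1
    (order_le_order_iff.1 huy _ ((hx.mem_pow_iff _ y).2 ⟨b, hb⟩))
  refine ⟨c, b, hndvd, ?_⟩
  have hu : (u : K) = x ^ _ * c := congrArg Subtype.val hc
  have hy : (y : K) = x ^ _ * b := congrArg Subtype.val hb
  rw [hu, hy, mul_div_mul_left _ _ (pow_ne_zero _ hx.coe_ne_zero), div_eq_mul_inv]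

theorem exists_coe_eq_pow_mul (hx : IsExceptionalEquation h x) {z : K}
    (hz : z ∈ blowupChart S.toSubring (maximalIdeal S.toSubring) x) :
    ∃ (n : ℕ) (y : S.toSubring), (y : K) = x ^ n * z := by
  obtain ⟨n, hn⟩ := exists_mul_pow_mem_of_mem_blowupChart le_rfl x.2
    (fun _ _ ↦ div_mul_self_mem hx.ne_zero) hz
  exact ⟨n, ⟨_, hn⟩, mul_comm _ _⟩

theorem orderValuationRing_eq [IsNoetherianRing T.toSubring] (hx : IsExceptionalEquation h x)
    {P : Ideal T.toSubring} [P.IsPrime] (hP : P = Ideal.span {Subring.inclusion h x}) :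
    orderValuationRing S = (ofPrime T.toSubring P).toSubring := by
  have hmem (s : T.toSubring) : s ∈ P ↔ Subring.inclusion h x ∣ s := by
    rw [hP, Ideal.mem_span_singleton]
  ext z
  rw [SetLike.mem_coe]
  constructor
  · intro hz
    obtain ⟨c, b, hb, rfl⟩ := hx.exists_notDvd_eq_div_of_mem_orderValuationRing hz
    exact mem_ofPrime_iff.2 ⟨c, b, (hmem b).not.2 hb, rfl⟩
  · intro hz
    have hchart := affineModel_trans hx.mem_affineModel ⟨P, inferInstance, rfl⟩
    have hle := (mem_affineModel_iff.1 hx.mem_affineModel).1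
    obtain ⟨c, hc, b, hb, hb0, hbi, rfl⟩ := (mem_affineModel_iff.1 hchart).2 z hz
    have hbP : (⟨b, hle hb⟩ : T.toSubring) ∉ P :=
      (inv_mem_ofPrime_iff (Subtype.coe_ne_coe.1 hb0)).1 hbi
    obtain ⟨n, u, hu⟩ := hx.exists_coe_eq_pow_mul hc
    obtain ⟨m, y, hy⟩ := hx.exists_coe_eq_pow_mul hb
    have hx0 := hx.coe_ne_zero
    have hord := hx.div_mem_orderValuationRing (y := y * x ^ n) (z := u * x ^ m) (n := n + m)
      (b := ⟨b, hle hb⟩) (c := ⟨c, hle hc⟩) (by push_cast [hy]; ring) (by push_cast [hu]; ring)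
      ((hmem _).not.1 hbP)
    convert hord using 1
    push_cast [hu, hy]
    field_simp

end IsExceptionalEquation

theorem eq_span_singleton_of_prime_of_height_eq_one {A : Type*} [CommRing A] [IsDomain A]
    {P : Ideal A} [P.IsPrime] (hP : P.height = 1) {p : A} (hp : Prime p) (hpP : p ∈ P) :
    P = Ideal.span {p} := by
  have hprime : (Ideal.span {p}).IsPrime := (Ideal.span_singleton_prime hp.ne_zero).2 hp
  by_contra hne
  have : P.FiniteHeight := ⟨.inr (by rw [hP]; exact ENat.one_ne_top)⟩
  have hlt := Ideal.height_strict_mono_of_isPrime_of_isPrime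
    (lt_of_le_of_ne ((Ideal.span_singleton_le_iff_mem _).2 hpP) (Ne.symm hne))
  rw [hP, Order.lt_one_iff, Ideal.height_eq_zero_iff_eq_bot, Ideal.span_singleton_eq_bot] at hlt
  exact hp.ne_zero hlt

theorem IsLocalQuadraticTransform.mem_affineModel_or_eq_orderValuationRing
    [IsRegularLocalRing S.toSubring] (h : IsLocalQuadraticTransform S T) {W : LocalSubring K}
    (hW : W ∈ affineModel T.toSubring) [IsDiscreteValuationRing W.toSubring] :
    W ∈ affineModel S.toSubring ∨ (W.toSubring : Set K) = orderValuationRing S := by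
  have := h.isRegularLocalRing
  obtain ⟨x, hx⟩ := h.exists_isExceptionalEquation
  by_cases hi : (x : K)⁻¹ ∈ W.toSubring
  · exact .inl (mem_affineModel_of_inv_mem hx.ne_zero (affineModel_trans hx.mem_affineModel hW) hi)
  · obtain ⟨P, hP, rfl⟩ := hW
    have hxP : Subring.inclusion h.1.1 x ∈ P := by
      by_contra hxP
      exact hi ((inv_mem_ofPrime_iff hx.prime.ne_zero).2 hxP)
    have hheight := height_eq_one_of_isDiscreteValuationRing P (ofPrime T.toSubring P).toSubring
    exact .inr (hx.orderValuationRing_eq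
      (eq_span_singleton_of_prime_of_height_eq_one hheight hx.prime hxP)).symm

theorem IsLocalQuadraticTransform.ne_of_two_le_ringKrullDim [IsRegularLocalRing S.toSubring]
    (h : IsLocalQuadraticTransform S T) (hdim : 2 ≤ ringKrullDim S.toSubring) : T ≠ S := by
  rintro rfl
  obtain ⟨x, hx⟩ := h.exists_isExceptionalEquation
  have hspan : maximalIdeal T.toSubring = Ideal.span {x} := by
    ext y
    rw [Ideal.mem_span_singleton, ← pow_one (maximalIdeal T.toSubring), hx.mem_pow_iff, pow_one]
    rfl
  have hrank : (maximalIdeal T.toSubring).spanFinrank ≤ 1 := by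
    rw [hspan, ← Set.ncard_singleton x]
    exact Submodule.spanFinrank_span_le_ncard_of_finite (Set.finite_singleton x)
  rw [← IsRegularLocalRing.spanFinrank_maximalIdeal] at hdim
  exact absurd (hdim.trans (Nat.cast_le.2 hrank)) (by decide)

end LocalQuadraticTransform

section ValuationSubring

variable {K : Type*} [Field K]

theorem exists_blowupChart_le_of_fg {A : Subring K} {V : ValuationSubring K} (hA : A ≤ V.toSubring)
    {J : Ideal A} (hJ : J.FG) (hJ0 : J ≠ ⊥) :
    ∃ a ∈ J, a ≠ 0 ∧ blowupChart A J a ≤ V.toSubring := by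
  obtain ⟨U, rfl⟩ := hJ
  have hne : U.Nonempty := by
    rw [Finset.nonempty_iff_ne_empty]
    rintro rfl
    exact hJ0 (by rw [Finset.coe_empty]; exact Submodule.span_empty)
  obtain ⟨a, haU, hmax⟩ := U.exists_max_image (fun u ↦ V.valuation (u : K)) hne
  have hle : ∀ u ∈ Submodule.span A (U : Set A), V.valuation (u : K) ≤ V.valuation (a : K) := by
    intro u hu
    induction hu using Submodule.span_induction with
    | mem u hu => exact hmax u hu
    | zero => simp
    | add u v _ _ hu hv => exact (V.valuation.map_add _ _).trans (max_le hu hv)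
    | smul r u _ hu =>
      rw [smul_eq_mul, Subring.coe_mul, map_mul]
      exact (mul_le_of_le_one_left' ((V.valuation_le_one_iff _).2 (hA r.2))).trans hu
  refine ⟨a, Submodule.subset_span haU, ?_, blowupChart_le hA fun x hx ↦ ?_⟩
  · rintro rfl
    refine hJ0 ((Submodule.eq_bot_iff _).2 fun u hu ↦ Subtype.ext ?_)
    simpa using hle u hu
  · change (x : K) / a ∈ V
    rw [← V.valuation_le_one_iff, map_div₀]
    exact div_le_one_of_le₀ (hle x hx) zero_le

theorem exists_isLocalQuadraticTransform_le {S : LocalSubring K} [IsNoetherianRing S.toSubring]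
    (hS : maximalIdeal S.toSubring ≠ ⊥) {V : ValuationSubring K} (hV : S ≤ V.toLocalSubring) :
    ∃ T, IsLocalQuadraticTransform S T ∧ T ≤ V.toLocalSubring := by
  obtain ⟨a, ha, ha0, hchart⟩ :=
    exists_blowupChart_le_of_fg hV.1 (IsNoetherian.noetherian (maximalIdeal S.toSubring)) hS
  obtain ⟨T, hT, hTV⟩ := exists_mem_affineModel_le (V := V.toLocalSubring) hchart
  have hST := (le_blowupChart _ _ _).trans (mem_affineModel_iff.1 hT).1
  exact ⟨T, ⟨le_of_toSubring_le_of_le hST hV hTV, a, ha, ha0, hT⟩, hTV⟩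

end ValuationSubring

section Stage

open LocalSubring

variable {K : Type*} [Field K] {R : LocalSubring K} {Γ : Set (LocalSubring K)} {k : ℕ}
  {T : LocalSubring K}

theorem ofPrime_maximalIdeal (R : LocalSubring K) :
    ofPrime R.toSubring (maximalIdeal R.toSubring) = R :=
  toSubring_injective (le_antisymm (ofPrime_le_of_forall_inv_mem le_rfl fun _ hs ↦
    (isUnit_iff_inv_mem.1 (notMem_maximalIdeal.1 hs)).2) (le_ofPrime _ _))

theorem le_of_mem_stage (hT : T ∈ stage R Γ k) : R.toSubring ≤ T.toSubring := by
  induction k generalizing T with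
  | zero => exact (mem_affineModel_iff.1 hT).1
  | succ k ih =>
    obtain ⟨hT, -⟩ | ⟨S, hS, -, hST⟩ := hT
    · exact ih hT
    · exact (ih hS).trans hST.1.1

theorem mem_saturatedModel_of_notMem (hT : T ∈ stage R Γ k) (hTΓ : T ∉ Γ) :
    T ∈ saturatedModel R Γ := by
  refine Filter.eventually_atTop.2 ⟨k, fun j hj ↦ ?_⟩
  induction j, hj using Nat.le_induction with
  | base => exact hT
  | succ j _ ih => exact .inl ⟨ih, hTΓ⟩

theorem exists_eq_ofPrime_or_isRegularLocalRing_of_mem_stage [IsRegularLocalRing R.toSubring]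
    (hΓ : ∀ Q ∈ Γ, IsInfinitelyNear R Q) (hT : T ∈ stage R Γ k) :
    (∃ (P : Ideal R.toSubring) (_ : P.IsPrime), P ≠ maximalIdeal R.toSubring ∧
      T = ofPrime R.toSubring P) ∨
    (IsRegularLocalRing T.toSubring ∧ Relation.ReflTransGen IsLocalQuadraticTransform R T) := by
  induction k generalizing T with
  | zero =>
    obtain ⟨P, hP, rfl⟩ := hT
    obtain rfl | h := eq_or_ne P (maximalIdeal R.toSubring)
    · rw [ofPrime_maximalIdeal]
      exact .inr ⟨inferInstance, .refl⟩
    · exact .inl ⟨P, hP, h, rfl⟩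
  | succ k ih =>
    obtain ⟨hT, -⟩ | ⟨S, -, hSΓ, hST⟩ := hT
    · exact ih hT
    · obtain ⟨hreg, -, hRS⟩ := hΓ S hSΓ
      exact .inr ⟨hST.isRegularLocalRing, hRS.tail hST⟩

theorem isNoetherianRing_of_mem_stage [IsRegularLocalRing R.toSubring]
    (hΓ : ∀ Q ∈ Γ, IsInfinitelyNear R Q) (hT : T ∈ stage R Γ k) :
    IsNoetherianRing T.toSubring := by
  obtain ⟨P, hP, -, rfl⟩ | ⟨hreg, -⟩ :=
    exists_eq_ofPrime_or_isRegularLocalRing_of_mem_stage hΓ hT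
  · exact IsLocalization.isNoetherianRing P.primeCompl _ inferInstance
  · infer_instance

theorem uniqueFactorizationMonoid_of_mem_stage [IsRegularLocalRing R.toSubring]
    (hΓ : ∀ Q ∈ Γ, IsInfinitelyNear R Q) (hT : T ∈ stage R Γ k) :
    UniqueFactorizationMonoid T.toSubring := by
  obtain ⟨P, hP, -, rfl⟩ | ⟨hreg, -⟩ :=
    exists_eq_ofPrime_or_isRegularLocalRing_of_mem_stage hΓ hT
  · exact UniqueFactorizationMonoid.of_isLocalization P.primeCompl _
  · infer_instance

theorem isIntegrallyClosed_of_mem_stage [IsRegularLocalRing R.toSubring]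
    (hΓ : ∀ Q ∈ Γ, IsInfinitelyNear R Q) (hT : T ∈ stage R Γ k) :
    IsIntegrallyClosed T.toSubring := by
  have := uniqueFactorizationMonoid_of_mem_stage hΓ hT
  infer_instance

/-- The local rings at the prime divisors of the models obtained from `Spec R` by blowing up points
of `Γ`: the discrete valuation rings that are localizations of `R` or order valuation rings of
points in `Γ`. -/
def divisorialRings (R : LocalSubring K) (Γ : Set (LocalSubring K)) : Set (LocalSubring K) :=
  {W | IsDiscreteValuationRing W.toSubring ∧ (W ∈ affineModel R.toSubring ∨
    ∃ Q ∈ Γ, (W.toSubring : Set K) = orderValuationRing Q)}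

theorem mem_divisorialRings_of_mem_stage (hΓ : ∀ Q ∈ Γ, IsInfinitelyNear R Q)
    (hT : T ∈ stage R Γ k) {W : LocalSubring K} (hW : W ∈ affineModel T.toSubring)
    [IsDiscreteValuationRing W.toSubring] : W ∈ divisorialRings R Γ := by
  refine ⟨inferInstance, ?_⟩
  induction k generalizing T with
  | zero => exact .inl (affineModel_trans hT hW)
  | succ k ih =>
    obtain ⟨hT, -⟩ | ⟨S, hS, hSΓ, hST⟩ := hT
    · exact ih hT hW
    · have := (hΓ S hSΓ).1
      obtain h | h := hST.mem_affineModel_or_eq_orderValuationRing hW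
      · exact ih hS h
      · exact .inr ⟨S, hSΓ, h⟩

theorem ofPrime_mem_divisorialRings_of_mem_stage [IsRegularLocalRing R.toSubring]
    (hΓ : ∀ Q ∈ Γ, IsInfinitelyNear R Q) (hT : T ∈ stage R Γ k) (q : Ideal T.toSubring)
    [q.IsPrime] (hq : q.height = 1) : ofPrime T.toSubring q ∈ divisorialRings R Γ := by
  have := isIntegrallyClosed_of_mem_stage hΓ hT
  have := isNoetherianRing_of_mem_stage hΓ hT
  have := isDiscreteValuationRing_of_height_eq_one q hq (ofPrime T.toSubring q).toSubring
  exact mem_divisorialRings_of_mem_stage hΓ hT ⟨q, inferInstance, rfl⟩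

theorem maximalIdeal_ne_bot_of_two_le_ringKrullDim {A : Type*} [CommRing A] [IsLocalRing A]
    (hA : 2 ≤ ringKrullDim A) : maximalIdeal A ≠ ⊥ := by
  intro h
  rw [ringKrullDim_eq_zero_of_isField (isField_iff_maximalIdeal_eq.2 h)] at hA
  exact absurd hA (by decide)

theorem exists_mem_stage_notMem_le (hΓ : ∀ Q ∈ Γ, IsInfinitelyNear R Q) (hfin : Γ.Finite)
    {V : ValuationSubring K} (hV : R.toSubring ≤ V.toSubring) :
    ∃ k, ∃ T ∈ stage R Γ k, T ∉ Γ ∧ T ≤ V.toLocalSubring := by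
  by_contra! hcon
  have hmem (k) {T} (hT : T ∈ stage R Γ k) (hTV : T ≤ V.toLocalSubring) : T ∈ Γ :=
    of_not_not fun h ↦ hcon k T hT h hTV
  have hcenters : {T | ∃ k, T ∈ stage R Γ k ∧ T ≤ V.toLocalSubring}.Finite :=
    hfin.subset fun T ⟨k, hT, hTV⟩ ↦ hmem k hT hTV
  obtain ⟨T₀, hT₀, hT₀V⟩ := exists_mem_affineModel_le (V := V.toLocalSubring) hV
  obtain ⟨T, ⟨k, hT, hTV⟩, hmax⟩ := hcenters.exists_maximal ⟨T₀, 0, hT₀, hT₀V⟩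
  have hTΓ := hmem k hT hTV
  obtain ⟨hreg, hdim, -⟩ := hΓ T hTΓ
  obtain ⟨T', hTT', hT'V⟩ :=
    exists_isLocalQuadraticTransform_le (maximalIdeal_ne_bot_of_two_le_ringKrullDim hdim) hTV
  have hle : T' ≤ T := hmax ⟨k + 1, .inr ⟨T, hT, hTΓ, hTT'⟩, hT'V⟩ hTT'.1
  exact hTT'.ne_of_two_le_ringKrullDim hdim (hle.antisymm hTT'.1)

end Stage

section PrincipalIdeals

variable {A : Type*} [CommRing A]

theorem exists_eq_span_singleton_mul_of_le {J : Ideal A} {a : A} (h : J ≤ Ideal.span {a}) :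
    ∃ L, J = Ideal.span {a} * L := by
  refine ⟨Submodule.comap (LinearMap.mulLeft A a) J, le_antisymm (fun x hx ↦ ?_)
    (Ideal.span_singleton_mul_le_iff.2 fun _ hz ↦ hz)⟩
  obtain ⟨c, rfl⟩ := Ideal.mem_span_singleton.1 (h hx)
  exact Ideal.mul_mem_mul (Ideal.mem_span_singleton_self a) hx

theorem exists_isLeast_span_singleton [UniqueFactorizationMonoid A] {J : Ideal A}
    (hJ : J.FG) (hJ0 : J ≠ ⊥) :
    ∃ a ≠ 0, IsLeast {L : Ideal A | J ≤ L ∧ ∃ b, L = Ideal.span {b}} (Ideal.span {a}) := by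
  classical
  let _ : StrongNormalizationMonoid A := UniqueFactorizationMonoid.strongNormalizationMonoid
  let _ := UniqueFactorizationMonoid.toNormalizedGCDMonoid A
  obtain ⟨s, rfl⟩ := hJ
  have hle (b : A) : Ideal.span (s : Set A) ≤ Ideal.span {b} ↔ b ∣ s.gcd id := by
    simp only [Finset.dvd_gcd_iff, Ideal.span_le, Set.subset_def, SetLike.mem_coe,
      Ideal.mem_span_singleton, id]
  refine ⟨s.gcd id, fun h0 ↦ hJ0 ?_, ⟨(hle _).2 dvd_rfl, _, rfl⟩, ?_⟩
  · exact le_bot_iff.1 (((hle 0).2 h0.symm.dvd).trans_eq (Ideal.span_singleton_eq_bot.2 rfl))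
  · rintro _ ⟨h, b, rfl⟩
    exact Ideal.span_singleton_le_span_singleton.2 ((hle b).1 h)

theorem isPrincipalIdealRing_of_not_two_le_ringKrullDim [IsRegularLocalRing A]
    (h : ¬ 2 ≤ ringKrullDim A) : IsPrincipalIdealRing A := by
  rw [← IsRegularLocalRing.spanFinrank_maximalIdeal] at h
  have hlt : (maximalIdeal A).spanFinrank < 2 := lt_of_not_ge fun h' ↦ h (by exact_mod_cast h')
  refine ((tfae_of_isNoetherianRing_of_isLocalRing_of_isDomain A).out 0 5).2 ?_
  rw [← spanFinrank_maximalIdeal_eq_finrank_cotangentSpace]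
  exact Nat.le_of_lt_succ hlt

theorem exists_mem_notMem_of_radical_eq_maximalIdeal [IsLocalRing A] {I : Ideal A}
    (hI : I.radical = maximalIdeal A) {P : Ideal A} [hP : P.IsPrime] (hPm : P ≠ maximalIdeal A) :
    ∃ x ∈ I, x ∉ P := by
  by_contra! hcon
  exact hPm (le_antisymm (le_maximalIdeal hP.ne_top) (hI ▸ hP.radical_le_iff.2 hcon))

theorem ne_bot_of_radical_eq_maximalIdeal [IsReduced A] [IsLocalRing A] (hA : 2 ≤ ringKrullDim A)
    {I : Ideal A} (hI : I.radical = maximalIdeal A) : I ≠ ⊥ := by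
  rintro rfl
  exact maximalIdeal_ne_bot_of_two_le_ringKrullDim hA
    (hI.symm.trans Ideal.radical_bot_of_isReduced)

end PrincipalIdeals

section Subring

variable {K : Type*} [Field K] {A B : Subring K}

theorem isFractionRing_of_le (h : A ≤ B) [IsFractionRing A K] : IsFractionRing B K := by
  refine IsFractionRing.of_field B K fun z ↦ ?_
  obtain ⟨x, y, -, rfl⟩ := IsFractionRing.div_surjective (A := A) z
  exact ⟨Subring.inclusion h x, Subring.inclusion h y, rfl⟩

theorem normalizedChart_le [IsFractionRing B K] [IsIntegrallyClosed B] {J : Ideal A} {a : A}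
    (h : blowupChart A J a ≤ B) : normalizedChart A J a ≤ B := by
  intro z (hz : IsIntegral (blowupChart A J a) z)
  let := (Subring.inclusion h).toAlgebra
  have : IsScalarTower (blowupChart A J a) B K := .of_algebraMap_eq fun _ ↦ rfl
  obtain ⟨y, rfl⟩ := IsIntegrallyClosed.isIntegral_iff.1 (hz.tower_top : IsIntegral B z)
  exact y.2

theorem blowupChart_le_normalizedChart (A : Subring K) (J : Ideal A) (a : A) :
    blowupChart A J a ≤ normalizedChart A J a := fun z hz ↦
  (integralClosure (blowupChart A J a) K).algebraMap_mem ⟨z, hz⟩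

theorem isIntegrallyClosedIn_of_mem_affineModel [IsIntegrallyClosedIn A K] {S : LocalSubring K}
    (hS : S ∈ affineModel A) : IsIntegrallyClosedIn S.toSubring K := by
  obtain ⟨P, hP, rfl⟩ := hS
  rw [isIntegrallyClosedIn_iff]
  refine ⟨Subtype.val_injective, fun {z} hz ↦ ?_⟩
  obtain ⟨m, hm⟩ := hz.exists_multiple_integral_of_isLocalization P.primeCompl z
  obtain ⟨b, hb⟩ := IsIntegrallyClosedIn.isIntegral_iff.1 hm
  have hm0 : ((m : A) : K) ≠ 0 := fun h ↦ m.2 ((Subtype.ext h : (m : A) = 0) ▸ zero_mem P)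
  have hbz : (b : K) = (m : A) * z := hb
  exact ⟨⟨z, mem_ofPrime_iff.2 ⟨b, m, m.2, by rw [hbz]; field_simp⟩⟩, rfl⟩

theorem isIntegrallyClosedIn_of_mem_normalizedBlowup {J : Ideal A} {S : LocalSubring K}
    (hS : S ∈ normalizedBlowup A J) : IsIntegrallyClosedIn S.toSubring K := by
  obtain ⟨a, -, -, hS⟩ := hS
  have : IsIntegrallyClosedIn (normalizedChart A J a) K :=
    inferInstanceAs (IsIntegrallyClosedIn (integralClosure _ K).toSubring K)
  exact isIntegrallyClosedIn_of_mem_affineModel hS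

theorem extendIdeal_ne_bot (hAB : A ≤ B) {I : Ideal A} (hI : I ≠ ⊥) : extendIdeal A I B ≠ ⊥ := by
  obtain ⟨x, hx, hx0⟩ := Submodule.exists_mem_ne_zero_of_ne_bot hI
  intro h
  have hx' := Ideal.span_eq_bot.1 h (Subring.inclusion hAB x) ⟨x, hx, rfl⟩
  exact hx0 (Subring.inclusion_injective hAB (hx'.trans (map_zero _).symm))

theorem exists_mem_forall_div_mem [IsLocalRing B] (hAB : A ≤ B) {I : Ideal A} {a : B} (ha : a ≠ 0)
    (h : extendIdeal A I B = Ideal.span {a}) : ∃ b ∈ I, b ≠ 0 ∧ ∀ x ∈ I, (x : K) / b ∈ B := by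
  obtain ⟨b', ⟨b, hb, hbb⟩, hassoc⟩ := exists_mem_associated_of_span_eq_span_singleton ha h
  have hb0 : b' ≠ 0 := hassoc.ne_zero_iff.2 ha
  have hbK : (b : K) ≠ 0 := hbb ▸ Subtype.coe_ne_coe.2 hb0
  refine ⟨b, hb, Subtype.coe_ne_coe.1 hbK, fun x hx ↦ ?_⟩
  have hax : a ∣ Subring.inclusion hAB x :=
    Ideal.mem_span_singleton.1 (h ▸ Ideal.subset_span ⟨x, hx, rfl⟩)
  obtain ⟨c, hc⟩ := hassoc.dvd.trans hax
  have hxbc : (x : K) = b * c := hbb ▸ congrArg Subtype.val hc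
  rw [hxbc, mul_div_cancel_left₀ _ hbK]
  exact c.2

open LocalSubring in
theorem mem_of_forall_mem_ofPrime [IsFractionRing A K] [IsIntegrallyClosed A] [IsNoetherianRing A]
    {z : K} (hz : ∀ (q : Ideal A) [q.IsPrime], q.height = 1 → z ∈ (ofPrime A q).toSubring) :
    z ∈ A := by
  obtain ⟨y, x, hx, rfl⟩ := IsFractionRing.div_surjective (A := A) z
  have hx0 : x ≠ 0 := nonZeroDivisors.ne_zero hx
  have hxK : (x : K) ≠ 0 := Subtype.coe_ne_coe.2 hx0
  suffices x ∣ y by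
    obtain ⟨c, rfl⟩ := this
    change ((x : K) * c) / x ∈ A
    rw [mul_div_cancel_left₀ _ hxK]
    exact c.2
  refine (dvd_iff_forall_height_eq_one hx0).2 fun q hq hht ↦ ?_
  obtain ⟨b, s, hs, h⟩ := mem_ofPrime_iff.1 (hz q hht)
  have hsK : (s : K) ≠ 0 := Subtype.coe_ne_coe.2 (ne_of_mem_of_not_mem (zero_mem q) hs).symm
  refine ⟨s, hs, b, Subtype.ext ?_⟩
  change (y : K) / x = b * (s : K)⁻¹ at h
  change (s : K) * y = x * b
  field_simp at h
  linear_combination h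

end Subring

section UnimodularPair

variable {K : Type*} [Field K]

/-- The elements `c` and `d` of `K` lie in the subring `W` and generate its unit ideal. -/
def IsUnimodularPair (W : Subring K) (c d : K) : Prop :=
  ∃ (hc : c ∈ W) (hd : d ∈ W), IsCoprime (⟨c, hc⟩ : W) ⟨d, hd⟩

namespace IsUnimodularPair

variable {W : Subring K} {c d z : K}

theorem symm (h : IsUnimodularPair W c d) : IsUnimodularPair W d c :=
  let ⟨hc, hd, hcd⟩ := h
  ⟨hd, hc, hcd.symm⟩

theorem of_isUnit_left {c d : W} (hc : IsUnit c) : IsUnimodularPair W c d :=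
  ⟨c.2, d.2, isCoprime_one_left.of_isCoprime_of_dvd_left hc.dvd⟩

theorem inv_mem (h : IsUnimodularPair W c (z * c)) (hz : z ∈ W) : c⁻¹ ∈ W := by
  obtain ⟨_, _, u, v, huv⟩ := h
  have hone : ((u : K) + v * z) * c = 1 := by
    rw [add_mul, mul_assoc]
    exact congrArg Subtype.val huv
  exact eq_inv_of_mul_eq_one_left hone ▸ add_mem u.2 (mul_mem v.2 hz)

theorem pow_div_pow {a : K} (h : IsUnimodularPair W c d) (ha : a ∈ W) (hai : a⁻¹ ∈ W) (ha0 : a ≠ 0)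
    (N j : ℕ) : IsUnimodularPair W (c ^ N / a ^ j) (d ^ N / a ^ j) := by
  obtain ⟨hc, hd, hcd⟩ := h
  have hu : IsUnit ((⟨a⁻¹, hai⟩ : W) ^ j) :=
    .pow _ (.of_mul_eq_one ⟨a, ha⟩ (Subtype.ext (inv_mul_cancel₀ ha0)))
  simp only [div_eq_mul_inv, ← inv_pow]
  exact ⟨mul_mem (pow_mem hc N) (pow_mem hai j), mul_mem (pow_mem hd N) (pow_mem hai j),
    (isCoprime_mul_unit_right hu _ _).2 (hcd.pow (m := N) (n := N))⟩

end IsUnimodularPair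

end UnimodularPair

open LocalSubring

variable {K : Type*} [Field K]

section DiscreteValuationRing

theorem exists_associated_pow_pow {W : Type*} [CommRing W] [IsDomain W]
    [IsDiscreteValuationRing W] {a w : W} (ha0 : a ≠ 0) (ha : ¬ IsUnit a) (hw0 : w ≠ 0) :
    ∃ N ≠ 0, ∃ j, Associated (a ^ j) (w ^ N) := by
  obtain ⟨p, hp⟩ := IsDiscreteValuationRing.exists_irreducible W
  obtain ⟨n, hn⟩ := IsDiscreteValuationRing.associated_pow_irreducible ha0 hp
  obtain ⟨m, hm⟩ := IsDiscreteValuationRing.associated_pow_irreducible hw0 hp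
  refine ⟨n, ?_, m, hn.pow_pow.trans ?_⟩
  · rintro rfl
    exact ha (associated_one_iff_isUnit.1 (pow_zero p ▸ hn))
  · rw [pow_right_comm]
    exact hm.symm.pow_pow

theorem exists_isUnimodularPair_pow_div_pow {W : Subring K} [IsDiscreteValuationRing W] {a w y : W}
    (ha0 : a ≠ 0) (ha : ¬ IsUnit a) (hw0 : w ≠ 0) :
    ∃ N ≠ 0, ∃ j, IsUnimodularPair W ((w : K) ^ N / a ^ j) ((y : K) ^ N / a ^ j) := by
  have of_dvd {w y : W} (hw0 : w ≠ 0) (h : w ∣ y) :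
      ∃ N ≠ 0, ∃ j, IsUnimodularPair W ((w : K) ^ N / a ^ j) ((y : K) ^ N / a ^ j) := by
    obtain ⟨c, rfl⟩ := h
    obtain ⟨N, hN, j, u, hu⟩ := exists_associated_pow_pow ha0 ha hw0
    have hwu : (w : K) ^ N / a ^ j = (u : W) := by
      rw [div_eq_iff (pow_ne_zero _ (Subtype.coe_ne_coe.2 ha0)), mul_comm]
      exact congrArg Subtype.val hu.symm
    refine ⟨N, hN, j, ?_⟩
    rw [Subring.coe_mul, mul_pow, mul_div_right_comm, hwu]
    exact .of_isUnit_left (d := (u : W) * c ^ N) u.isUnit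
  obtain h | h := ValuationRing.dvd_total w y
  · exact of_dvd hw0 h
  · obtain ⟨N, hN, j, hpair⟩ := of_dvd (fun hy0 ↦ hw0 (zero_dvd_iff.1 (hy0 ▸ h))) h
    exact ⟨N, hN, j, hpair.symm⟩

theorem isUnimodularPair_of_isRelPrime {A : Subring K} [UniqueFactorizationMonoid A]
    {W : LocalSubring K} (hW : W ∈ affineModel A) [IsDiscreteValuationRing W.toSubring] {y w : A}
    (h : IsRelPrime y w) : IsUnimodularPair W.toSubring y w := by
  obtain ⟨P, hP, rfl⟩ := hW
  obtain ⟨p, hp⟩ := UniqueFactorizationMonoid.isPrincipal_of_height_eq_one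
    (height_eq_one_of_isDiscreteValuationRing P (ofPrime A P).toSubring)
  have hmem (r : A) : r ∈ P ↔ p ∣ r := by
    rw [hp]
    exact Ideal.mem_span_singleton
  have hunit {r : A} (hr : r ∉ P) : IsUnit (algebraMap A (ofPrime A P).toSubring r) :=
    IsLocalization.map_units _ (⟨r, hr⟩ : P.primeCompl)
  by_cases hy : y ∈ P
  · have hw : w ∉ P := fun hw ↦ hP.ne_top (Ideal.eq_top_of_isUnit_mem _ ((hmem p).2 dvd_rfl)
      (h ((hmem y).1 hy) ((hmem w).1 hw)))
    exact (IsUnimodularPair.of_isUnit_left (d := algebraMap A _ y) (hunit hw)).symm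
  · exact .of_isUnit_left (d := algebraMap A _ w) (hunit hy)

end DiscreteValuationRing

section InfinitelyNear

theorem le_of_isInfinitelyNear {R Q : LocalSubring K} (h : IsInfinitelyNear R Q) : R ≤ Q := by
  obtain ⟨-, -, h⟩ := h
  induction h with
  | refl => exact le_rfl
  | tail _ h ih => exact ih.trans h.1

theorem inv_notMem_orderValuationRing {Q : LocalSubring K} [IsNoetherianRing Q.toSubring]
    {a : Q.toSubring} (ha : a ∈ maximalIdeal Q.toSubring) (ha0 : a ≠ 0) :
    (a : K)⁻¹ ∉ orderValuationRing Q := by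
  rintro ⟨x, y, hy0, hxy, h⟩
  have haK : (a : K) ≠ 0 := Subtype.coe_ne_coe.2 ha0
  have hyK : (y : K) ≠ 0 := Subtype.coe_ne_coe.2 hy0
  have hyax : y = a * x := Subtype.ext (by
    rw [Subring.coe_mul]
    field_simp at h
    exact h)
  rw [order_le_order_iff] at hxy
  have hx (n : ℕ) : x ∈ maximalIdeal Q.toSubring ^ n := by
    induction n with
    | zero => simp
    | succ n ih =>
      refine hxy _ ?_
      rw [hyax, pow_succ']
      exact Ideal.mul_mem_mul ha ih
  have hx0 : x = 0 := by
    rw [← Ideal.mem_bot, ← Ideal.iInf_pow_eq_bot_of_isLocalRing (maximalIdeal Q.toSubring)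
      (maximalIdeal.isMaximal _).ne_top, Ideal.mem_iInf]
    exact hx
  exact hy0 (by rw [hyax, hx0, mul_zero])

theorem inv_notMem_orderValuationRing_of_isInfinitelyNear {R Q : LocalSubring K}
    (hQ : IsInfinitelyNear R Q) {a : R.toSubring} (ha : a ∈ maximalIdeal R.toSubring)
    (ha0 : a ≠ 0) : (a : K)⁻¹ ∉ orderValuationRing Q := by
  obtain ⟨hle, hloc⟩ := le_of_isInfinitelyNear hQ
  have := hQ.1
  have haQ : Subring.inclusion hle a ∈ maximalIdeal Q.toSubring := by
    rw [mem_maximalIdeal, mem_nonunits_iff, isUnit_map_iff]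
    exact ha
  exact inv_notMem_orderValuationRing haQ
    ((map_ne_zero_iff _ (Subring.inclusion_injective hle)).2 ha0)

end InfinitelyNear

section NormalizedBlowup

variable {R S T : LocalSubring K} {I : Ideal R.toSubring} {k : ℕ}

theorem exists_extendIdeal_eq_span_singleton [IsRegularLocalRing T.toSubring]
    (hRT : Relation.ReflTransGen IsLocalQuadraticTransform R T) (hTΓ : T ∉ basePoints R I)
    (hI : extendIdeal R.toSubring I T.toSubring ≠ ⊥) :
    ∃ a ≠ 0, extendIdeal R.toSubring I T.toSubring = Ideal.span {a} := by
  by_cases hdim : 2 ≤ ringKrullDim T.toSubring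
  · obtain ⟨a, ha0, hleast⟩ := exists_isLeast_span_singleton (IsNoetherian.noetherian _) hI
    obtain ⟨J, hJ⟩ := exists_eq_span_singleton_mul_of_le hleast.1.1
    have hJtop : J = ⊤ := by
      by_contra hne
      exact hTΓ ⟨⟨‹_›, hdim, hRT⟩, J, ⟨a, ha0, hleast, hJ⟩, hne⟩
    exact ⟨a, ha0, by rw [hJ, hJtop, Ideal.mul_top]⟩
  · have := isPrincipalIdealRing_of_not_two_le_ringKrullDim hdim
    obtain ⟨a, ha⟩ := IsPrincipalIdealRing.principal (extendIdeal R.toSubring I T.toSubring)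
    exact ⟨a, fun h0 ↦ hI (ha.trans (Ideal.span_singleton_eq_bot.2 h0)), ha⟩

theorem inv_mem_of_forall_div_mem (hdim : 2 ≤ ringKrullDim R.toSubring)
    (hI : I.radical = maximalIdeal R.toSubring) {W : LocalSubring K}
    (hW : W ∈ affineModel R.toSubring) [IsDiscreteValuationRing W.toSubring] {a : R.toSubring}
    (ha : ∀ x ∈ I, (x : K) / a ∈ W.toSubring) : (a : K)⁻¹ ∈ W.toSubring := by
  obtain ⟨P, hP, rfl⟩ := hW
  have hPm : P ≠ maximalIdeal R.toSubring := by
    rintro rfl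
    rw [← maximalIdeal_height_eq_ringKrullDim,
      height_eq_one_of_isDiscreteValuationRing (maximalIdeal R.toSubring)
        (ofPrime R.toSubring (maximalIdeal R.toSubring)).toSubring] at hdim
    exact absurd hdim (by decide)
  obtain ⟨x, hx, hxP⟩ := exists_mem_notMem_of_radical_eq_maximalIdeal hI hPm
  have hx0 : x ≠ 0 := (ne_of_mem_of_not_mem (zero_mem P) hxP).symm
  have hainv : (a : K)⁻¹ = (x : K)⁻¹ * (x / a) := by
    rw [div_eq_mul_inv, inv_mul_cancel_left₀ (Subtype.coe_ne_coe.2 hx0)]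
  exact hainv ▸ mul_mem ((inv_mem_ofPrime_iff hx0).2 hxP) (ha x hx)

variable [IsRegularLocalRing R.toSubring]

theorem exists_div_mem_of_mem_stage_of_notMem (hdim : 2 ≤ ringKrullDim R.toSubring)
    (hI : I.radical = maximalIdeal R.toSubring) (hT : T ∈ stage R (basePoints R I) k)
    (hTΓ : T ∉ basePoints R I) : ∃ b ∈ I, b ≠ 0 ∧ ∀ x ∈ I, (x : K) / b ∈ T.toSubring := by
  have hRT := le_of_mem_stage hT
  obtain ⟨P, hP, hPm, rfl⟩ | ⟨hreg, htrans⟩ :=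
    exists_eq_ofPrime_or_isRegularLocalRing_of_mem_stage (fun _ hQ ↦ hQ.1) hT
  · obtain ⟨b, hb, hbP⟩ := exists_mem_notMem_of_radical_eq_maximalIdeal hI hPm
    have hb0 : b ≠ 0 := (ne_of_mem_of_not_mem (zero_mem P) hbP).symm
    exact ⟨b, hb, hb0, fun x _ ↦
      div_eq_mul_inv (x : K) b ▸ mul_mem (hRT x.2) ((inv_mem_ofPrime_iff hb0).2 hbP)⟩
  · obtain ⟨a, ha, h⟩ := exists_extendIdeal_eq_span_singleton htrans hTΓ
      (extendIdeal_ne_bot hRT (ne_bot_of_radical_eq_maximalIdeal hdim hI))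
    exact exists_mem_forall_div_mem hRT ha h

variable [IsFractionRing R.toSubring K]

theorem exists_mem_stage_notMem_le_of_le (hdim : 2 ≤ ringKrullDim R.toSubring)
    (hI : I.radical = maximalIdeal R.toSubring) (hfin : (basePoints R I).Finite)
    (hS : S ∈ normalizedBlowup R.toSubring I) {V : ValuationSubring K}
    (hV : S ≤ V.toLocalSubring) :
    ∃ k, ∃ T ∈ stage R (basePoints R I) k, T ∉ basePoints R I ∧ T ≤ V.toLocalSubring ∧ S ≤ T := by
  obtain ⟨a, haI, -, hSa⟩ := hS
  have hchartV : blowupChart R.toSubring I a ≤ V.toSubring :=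
    ((blowupChart_le_normalizedChart _ I a).trans (mem_affineModel_iff.1 hSa).1).trans hV.1
  obtain ⟨k, T, hT, hTΓ, hTV⟩ := exists_mem_stage_notMem_le (fun _ hQ ↦ hQ.1) hfin
    ((le_blowupChart R.toSubring I a).trans hchartV)
  refine ⟨k, T, hT, hTΓ, hTV, ?_⟩
  obtain ⟨b, hb, hb0, hdiv⟩ := exists_div_mem_of_mem_stage_of_notMem hdim hI hT hTΓ
  have hba : (b : K) / a ∈ T.toSubring := by
    rw [← inv_div]
    refine (le_iff_inv_mem.1 hTV).2 _ (hdiv a haI) ?_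
    rw [inv_div]
    exact hchartV (div_mem_blowupChart hb)
  have hRT := le_of_mem_stage hT
  have hchartT : blowupChart R.toSubring I a ≤ T.toSubring := blowupChart_le hRT fun x hx ↦
    div_mul_div_cancel₀ (Subtype.coe_ne_coe.2 hb0 : (b : K) ≠ 0) ▸ mul_mem (hdiv x hx) hba
  have := isFractionRing_of_le hRT
  have := isIntegrallyClosed_of_mem_stage (fun _ hQ ↦ hQ.1) hT
  exact le_of_mem_affineModel_of_le hSa (normalizedChart_le hchartT) hV hTV

theorem mem_of_forall_mem_divisorialRings_of_mem_stage (hT : T ∈ stage R (basePoints R I) k)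
    {z : K} (hz : ∀ W ∈ divisorialRings R (basePoints R I),
      T.toSubring ≤ W.toSubring → z ∈ W.toSubring) : z ∈ T.toSubring := by
  have hΓ (Q) (hQ : Q ∈ basePoints R I) : IsInfinitelyNear R Q := hQ.1
  have := isIntegrallyClosed_of_mem_stage hΓ hT
  have := isNoetherianRing_of_mem_stage hΓ hT
  have := isFractionRing_of_le (le_of_mem_stage hT)
  exact mem_of_forall_mem_ofPrime fun q _ hq ↦
    hz _ (ofPrime_mem_divisorialRings_of_mem_stage hΓ hT q hq) (le_ofPrime _ _)

theorem mem_of_forall_mem_divisorialRings (hdim : 2 ≤ ringKrullDim R.toSubring)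
    (hI : I.radical = maximalIdeal R.toSubring) (hfin : (basePoints R I).Finite)
    (hS : S ∈ normalizedBlowup R.toSubring I) {z : K}
    (hz : ∀ W ∈ divisorialRings R (basePoints R I), S.toSubring ≤ W.toSubring → z ∈ W.toSubring) :
    z ∈ S.toSubring := by
  by_contra hzS
  have := isIntegrallyClosedIn_of_mem_normalizedBlowup hS
  obtain ⟨V, hSV, hzV⟩ := exists_le_valuationSubring_of_isIntegrallyClosedIn hzS
  obtain ⟨k, T, hT, -, hTV, hST⟩ := exists_mem_stage_notMem_le_of_le hdim hI hfin hS hSV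
  exact hzV (hTV.1 (mem_of_forall_mem_divisorialRings_of_mem_stage hT fun W hW hTW ↦
    hz W hW (hST.1.trans hTW)))

end NormalizedBlowup

section Biregular

variable {R S T : LocalSubring K} {I : Ideal R.toSubring} {k : ℕ}

theorem mem_of_pow_mem_of_mem_normalizedBlowup {z : K}
    (hS : S ∈ normalizedBlowup R.toSubring I) {n : ℕ} (hn : n ≠ 0) (hz : z ^ n ∈ S.toSubring) :
    z ∈ S.toSubring := by
  have := isIntegrallyClosedIn_of_mem_normalizedBlowup hS
  have hint : IsIntegral S.toSubring (z ^ n) :=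
    isIntegral_algebraMap (x := (⟨z ^ n, hz⟩ : S.toSubring))
  obtain ⟨s, rfl⟩ :=
    IsIntegrallyClosedIn.exists_algebraMap_eq_of_isIntegral_pow (Nat.pos_of_ne_zero hn) hint
  exact s.2

theorem exists_forall_orderValuationRing_isUnimodularPair
    (hone : ∀ Q ∈ basePoints R I, ∀ Q' ∈ basePoints R I,
      (S.toSubring : Set K) ⊆ orderValuationRing Q →
      (S.toSubring : Set K) ⊆ orderValuationRing Q' → Q = Q')
    (hRS : R.toSubring ≤ S.toSubring) {a w : R.toSubring} (ha : a ∈ maximalIdeal R.toSubring)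
    (ha0 : a ≠ 0) (hw0 : w ≠ 0) (y : R.toSubring) :
    ∃ N ≠ 0, ∃ j, ∀ W : LocalSubring K, IsDiscreteValuationRing W.toSubring →
      S.toSubring ≤ W.toSubring →
      (∃ Q ∈ basePoints R I, (W.toSubring : Set K) = orderValuationRing Q) →
      IsUnimodularPair W.toSubring ((w : K) ^ N / (a : K) ^ j) ((y : K) ^ N / (a : K) ^ j) := by
  by_cases hex : ∃ W : LocalSubring K, IsDiscreteValuationRing W.toSubring ∧
      S.toSubring ≤ W.toSubring ∧
      ∃ Q ∈ basePoints R I, (W.toSubring : Set K) = orderValuationRing Q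
  swap
  · exact ⟨1, one_ne_zero, 0, fun W hdvr hSW hQ ↦ absurd ⟨W, hdvr, hSW, hQ⟩ hex⟩
  obtain ⟨W₀, hdvr, hSW₀, Q₀, hQ₀, hWQ₀⟩ := hex
  let ι := Subring.inclusion (hRS.trans hSW₀)
  have hι {r : R.toSubring} (hr : r ≠ 0) : ι r ≠ 0 :=
    (map_ne_zero_iff ι (Subring.inclusion_injective _)).2 hr
  have hau : ¬ IsUnit (ι a) := fun h ↦
    inv_notMem_orderValuationRing_of_isInfinitelyNear hQ₀.1 ha ha0
      (hWQ₀ ▸ (isUnit_iff_inv_mem.1 h).2)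
  obtain ⟨N, hN, j, hpair⟩ := exists_isUnimodularPair_pow_div_pow (y := ι y) (hι ha0) hau (hι hw0)
  refine ⟨N, hN, j, fun W _ hSW ⟨Q, hQ, hWQ⟩ ↦ ?_⟩
  have hQQ : Q = Q₀ := hone Q hQ Q₀ hQ₀ (hWQ ▸ hSW) (hWQ₀ ▸ hSW₀)
  obtain rfl : W = W₀ := toSubring_injective (SetLike.coe_injective (by rw [hWQ, hWQ₀, hQQ]))
  exact hpair

variable [IsRegularLocalRing R.toSubring]

theorem exists_forall_divisorialRings_isUnimodularPair (hdim : 2 ≤ ringKrullDim R.toSubring)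
    (hI : I.radical = maximalIdeal R.toSubring)
    (hone : ∀ Q ∈ basePoints R I, ∀ Q' ∈ basePoints R I,
      (S.toSubring : Set K) ⊆ orderValuationRing Q →
      (S.toSubring : Set K) ⊆ orderValuationRing Q' → Q = Q')
    {a w y : R.toSubring} (haI : a ∈ I) (ha0 : a ≠ 0)
    (hS : blowupChart R.toSubring I a ≤ S.toSubring) (hw0 : w ≠ 0) (hrel : IsRelPrime y w) :
    ∃ N ≠ 0, ∃ j, ∀ W ∈ divisorialRings R (basePoints R I), S.toSubring ≤ W.toSubring →
      IsUnimodularPair W.toSubring ((w : K) ^ N / (a : K) ^ j) ((y : K) ^ N / (a : K) ^ j) := by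
  have hRS : R.toSubring ≤ S.toSubring := (le_blowupChart _ I a).trans hS
  obtain ⟨N, hN, j, hord⟩ := exists_forall_orderValuationRing_isUnimodularPair hone hRS
    ((hI ▸ Ideal.le_radical : I ≤ maximalIdeal R.toSubring) haI) ha0 hw0 y
  refine ⟨N, hN, j, ?_⟩
  rintro W ⟨hdvr, hWR | hWQ⟩ hSW
  · exact (isUnimodularPair_of_isRelPrime hWR hrel).symm.pow_div_pow (hSW (hRS a.2))
      (inv_mem_of_forall_div_mem hdim hI hWR fun x hx ↦ hSW (hS (div_mem_blowupChart hx)))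
      (Subtype.coe_ne_coe.2 ha0) N j
  · exact hord W hdvr hSW hWQ

variable [IsFractionRing R.toSubring K]

theorem eq_of_mem_stage_of_le (hdim : 2 ≤ ringKrullDim R.toSubring)
    (hI : I.radical = maximalIdeal R.toSubring) (hfin : (basePoints R I).Finite)
    (hS : S ∈ normalizedBlowup R.toSubring I)
    (hone : ∀ Q ∈ basePoints R I, ∀ Q' ∈ basePoints R I,
      (S.toSubring : Set K) ⊆ orderValuationRing Q →
      (S.toSubring : Set K) ⊆ orderValuationRing Q' → Q = Q')
    (hT : T ∈ stage R (basePoints R I) k) (hST : S ≤ T) : T = S := by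
  refine eq_of_le_of_toSubring_le hST fun z hz ↦ ?_
  obtain ⟨a, haI, ha0, hSa⟩ := id hS
  have hchartS := (blowupChart_le_normalizedChart _ I a).trans (mem_affineModel_iff.1 hSa).1
  obtain ⟨y, w, hrel, hyw⟩ := IsFractionRing.exists_reduced_fraction R.toSubring z
  replace hyw : z = (y : K) / (w : R.toSubring) := hyw ▸ IsFractionRing.mk'_eq_div w
  have hw0 : (w : R.toSubring) ≠ 0 := nonZeroDivisors.ne_zero w.2
  obtain ⟨N, hN, j, hpair⟩ :=
    exists_forall_divisorialRings_isUnimodularPair hdim hI hone haI ha0 hchartS hw0 hrel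
  set c : K := (w : R.toSubring) ^ N / (a : K) ^ j
  set d : K := (y : K) ^ N / (a : K) ^ j
  have hc0 : c ≠ 0 := div_ne_zero (pow_ne_zero _ (Subtype.coe_ne_coe.2 hw0))
    (pow_ne_zero _ (Subtype.coe_ne_coe.2 ha0))
  have hd : d = z ^ N * c := by
    rw [hyw, div_pow, div_mul_div_cancel₀ (pow_ne_zero _ (Subtype.coe_ne_coe.2 hw0))]
  have hcS : c ∈ S.toSubring :=
    mem_of_forall_mem_divisorialRings hdim hI hfin hS fun W hW hSW ↦ (hpair W hW hSW).1
  have hdS : d ∈ S.toSubring :=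
    mem_of_forall_mem_divisorialRings hdim hI hfin hS fun W hW hSW ↦ (hpair W hW hSW).symm.1
  have hcT : c⁻¹ ∈ T.toSubring := mem_of_forall_mem_divisorialRings_of_mem_stage hT
    fun W hW hTW ↦ (hd ▸ hpair W hW (hST.1.trans hTW)).inv_mem (pow_mem (hTW hz) N)
  refine mem_of_pow_mem_of_mem_normalizedBlowup hS hN ?_
  rw [← mul_inv_cancel_right₀ hc0 (z ^ N), ← hd]
  exact mul_mem hdS ((le_iff_inv_mem.1 hST).2 c hcS hcT)

end Biregular

section DivisorClassGroup

variable {A : Type*} [CommRing A] [IsDomain A] [IsNoetherianRing A] [UniqueFactorizationMonoid A]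

theorem single_mem_principalDivisors (P : HeightOnePrime A) :
    Finsupp.single P 1 ∈ principalDivisors A := by
  classical
  obtain ⟨p, hp⟩ := UniqueFactorizationMonoid.isPrincipal_of_height_eq_one P.2.2
  replace hp : P.1 = Ideal.span {p} := hp
  have hp0 : p ≠ 0 := by
    rintro rfl
    have hht := P.2.2
    rw [hp, Ideal.span_singleton_eq_bot.2 rfl, Ideal.height_bot] at hht
    exact zero_ne_one hht
  refine AddSubgroup.subset_closure ⟨p, hp0, fun P' ↦ ?_⟩
  obtain rfl | h := eq_or_ne P' P
  · have := isDiscreteValuationRing_of_height_eq_one P'.1 P'.2.2 (Localization.AtPrime P'.1)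
    refine ⟨1, Ring.ord_of_irreducible ?_, by simp⟩
    rw [IsDiscreteValuationRing.irreducible_iff_uniformizer,
      ← Localization.AtPrime.map_eq_maximalIdeal, ← Set.image_singleton, ← Ideal.map_span, ← hp]
  · refine ⟨0, ordAlong_eq_zero_iff.2 fun hpP' ↦ ?_, by simp [h.symm]⟩
    exact HeightOnePrime.not_le_of_ne h.symm (hp ▸ (Ideal.span_singleton_le_iff_mem _).2 hpP')

theorem subsingleton_divisorClassGroup (A : Type*) [CommRing A] [IsDomain A] [IsNoetherianRing A]
    [UniqueFactorizationMonoid A] : Subsingleton (DivisorClassGroup A) := by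
  rw [QuotientAddGroup.subsingleton_iff, eq_top_iff]
  intro D _
  induction D using Finsupp.induction_linear with
  | zero => exact zero_mem _
  | add f g hf hg => exact add_mem (hf trivial) (hg trivial)
  | single P n => simpa using (principalDivisors A).zsmul_mem (single_mem_principalDivisors P) n

end DivisorClassGroup

end BlowupModel

open BlowupModel in
theorem mainTheorem7_general {K : Type*} [Field K] (R : LocalSubring K)
    [IsFractionRing R.toSubring K] [IsRegularLocalRing R.toSubring]
    (hdim : 2 ≤ ringKrullDim R.toSubring)
    (I : Ideal R.toSubring) (hI : I.radical = maximalIdeal R.toSubring)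
    (hfin : (basePoints R I).Finite) (S : LocalSubring K)
    (hS : S ∈ normalizedBlowup R.toSubring I)
    (hone : ∀ Q ∈ basePoints R I, ∀ Q' ∈ basePoints R I,
      (S.toSubring : Set K) ⊆ orderValuationRing Q →
      (S.toSubring : Set K) ⊆ orderValuationRing Q' → Q = Q') :
    Subsingleton (DivisorClassGroup S.toSubring) ∧
      IsBiregularAt (saturatedModel R (basePoints R I)) S := by
  obtain ⟨V, hV⟩ := S.exists_le_valuationSubring
  obtain ⟨k, T, hT, hTΓ, -, hST⟩ := exists_mem_stage_notMem_le_of_le hdim hI hfin hS hV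
  obtain rfl := eq_of_mem_stage_of_le hdim hI hfin hS hone hT hST
  constructor
  · have hΓ (Q) (hQ : Q ∈ basePoints R I) : IsInfinitelyNear R Q := hQ.1
    have := isNoetherianRing_of_mem_stage hΓ hT
    have := uniqueFactorizationMonoid_of_mem_stage hΓ hT
    exact subsingleton_divisorClassGroup T.toSubring
  · refine Set.eq_singleton_iff_unique_mem.2
      ⟨⟨mem_saturatedModel_of_notMem hT hTΓ, le_rfl⟩, fun T' ⟨hT', hle⟩ ↦ ?_⟩
    obtain ⟨j, hj⟩ := hT'.exists
    exact eq_of_mem_stage_of_le hdim hI hfin hS hone hj hle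

theorem mainTheorem7 {K : Type*} [Field K] (R : LocalSubring K)
    [IsFractionRing R.toSubring K] [IsRegularLocalRing R.toSubring]
    (hdim : 2 ≤ ringKrullDim R.toSubring)
    (I : Ideal R.toSubring) (hI : I.radical = IsLocalRing.maximalIdeal R.toSubring)
    (hfin : (BlowupModel.basePoints R I).Finite)
    (hRees : ∀ Q ∈ BlowupModel.basePoints R I,
      ∃ V ∈ BlowupModel.reesValuationRings R.toSubring I,
        (V.toSubring : Set K) = BlowupModel.orderValuationRing Q)
    (S : LocalSubring K) (hS : S ∈ BlowupModel.normalizedBlowup R.toSubring I)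
    (hone : ∀ Q ∈ BlowupModel.basePoints R I, ∀ Q' ∈ BlowupModel.basePoints R I,
      (S.toSubring : Set K) ⊆ BlowupModel.orderValuationRing Q →
      (S.toSubring : Set K) ⊆ BlowupModel.orderValuationRing Q' → Q = Q') :
    IsAddTorsion (BlowupModel.DivisorClassGroup S.toSubring) ∧
      BlowupModel.IsBiregularAt
        (BlowupModel.saturatedModel R (BlowupModel.basePoints R I)) S := by
  obtain ⟨_, hbiregular⟩ := mainTheorem7_general R hdim I hI hfin S hS hone
  exact ⟨fun D ↦ Subsingleton.elim 0 D ▸ .zero, hbiregular⟩
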